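/- Let $k$ be a field, let $h_1,\dots,h_m$ be nonzero linear forms on $\mathbb R^d$ and $c_1,\dots,c_m\in\mathbb R$, and let $\mathcal A$ be the oriented affine hyperplane arrangement with hyperplanes $\mathcal H_j=\{v\in\mathbb R^d: h_j(v)=c_j\}$. Put $\mathbf S=k[x_1,\dots,x_m,y_1,\dots,y_m]$, $\mathbf R=k[x_1,\dots,x_m]$, and let $$\mathcal O=\Big\langle \prod_{h_i(v)>c_i}x_i\prod_{h_i(v)<c_i}y_i \ :\ v\in\mathbb R^d\Big\rangle\subset\mathbf S,\qquad \bar{\mathcal O}=\Big\langle \prod_{h_i(v)\neq c_i}x_i\ :\ v\in\mathbb R^d\Big\rangle\subset\mathbf R$$ be the oriented matroid ideal of $\mathcal A$ and its specialization at $y_i=x_i$. Write $I^\vee$ for the Alexander dual of a squarefree monomial ideal $I$, i.e. the intersection of the primes $\langle z: z \text{ divides } \mu\rangle$ over the squarefree monomials $\mu\in I$. Write $\beta_{i,a}(I)$ for the number of generators of degree $a$ in the $i$-th free module of a minimal graded free resolution of the ideal $I$ (such resolutions exist and these numbers do not depend on the choice). Then: (i) The elements $x_1-y_1,\dots,x_m-y_m$,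 in any order, form a regular sequence on $\mathbf S/\mathcal O^\vee$. (ii) The $\mathbb Z$-graded and the multigraded Betti numbers of $\mathcal O^\vee\subset\mathbf S$ and $\bar{\mathcal O}^\vee\subset\mathbf R$ coincide: for all $i\ge 0$, - $\beta_{i,j}(\mathcal O^\vee)=\beta_{i,j}(\bar{\mathcal O}^\vee)$ for all $j\in\mathbb Z$, in the standard grading; - $\beta_{i,a}(\mathcal O^\vee)=\beta_{i,a}(\bar{\mathcal O}^\vee)$ for all $a\in\mathbb Z^m$, in the $\mathbb Z^m$-grading in which $x_l$ and $y_l$ both have degree $e_l$; - for all $a\in\mathbb Z^m$, $\ \beta_{i,a}(\bar{\mathcal O}^\vee)=\sum_{b+c=a}\beta_{i,(b,c)}(\mathcal O^\vee)$, where $(b,c)\in\mathbb Z^m\times\mathbb Z^m$ runs over the degrees of the fine $\mathbb Z^{2m}$-grading of $\mathbf S$. -/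

import Mathlib

/-- An oriented affine hyperplane arrangement `{H_1, …, H_m}` in `ℝ^d`: nonzero linear forms `h_j`
and constants `c_j`, with `H_j = {v | h_j v = c_j}` and positive side `{v | h_j v > c_j}`. -/
structure OrientedArrangement (d m : ℕ) where
  h : Fin m → Module.Dual ℝ (Fin d → ℝ)
  c : Fin m → ℝ
  h_ne_zero : ∀ j, h j ≠ 0

namespace OrientedArrangement

open MvPolynomial

noncomputable section

variable {d m : ℕ} (𝒜 : OrientedArrangement d m) (k : Type*) [Field k]

/-- The monomial `∏_{h_i(v) > c_i} x_i * ∏_{h_i(v) < c_i} y_i` of a point `v`.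
The variable `x_i` is `X (Sum.inl i)`, the variable `y_i` is `X (Sum.inr i)`. -/
def pointMonomial (v : Fin d → ℝ) : MvPolynomial (Fin m ⊕ Fin m) k :=
  (∏ i with 𝒜.c i < 𝒜.h i v, X (Sum.inl i)) * ∏ i with 𝒜.h i v < 𝒜.c i, X (Sum.inr i)

/-- The oriented matroid ideal `𝒪` in `S = k[x_1, …, x_m, y_1, …, y_m]`. -/
def orientedMatroidIdeal : Ideal (MvPolynomial (Fin m ⊕ Fin m) k) :=
  Ideal.span (Set.range (𝒜.pointMonomial k))

/-- The unsigned monomial `∏_{h_i(v) ≠ c_i} x_i` of a point `v`. -/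
def unsignedPointMonomial (v : Fin d → ℝ) : MvPolynomial (Fin m) k :=
  ∏ i with 𝒜.h i v ≠ 𝒜.c i, X i

/-- The specialization of `𝒪` at `y_i = x_i`, an ideal in `R = k[x_1, …, x_m]`. -/
def matroidIdeal : Ideal (MvPolynomial (Fin m) k) :=
  Ideal.span (Set.range (𝒜.unsignedPointMonomial k))

end

end OrientedArrangement

/-- The Alexander dual of a squarefree monomial ideal `I`: the intersection of the monomial primes
`⟨z_i : i ∈ s⟩` over all squarefree monomials `∏_{i ∈ s} z_i` in `I`. It suffices to let the
monomial run over squarefree generators of `I`, since a larger `s` gives a larger prime. -/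
noncomputable def alexanderDual {k ι : Type*} [Field k] (I : Ideal (MvPolynomial ι k)) :
    Ideal (MvPolynomial ι k) :=
  ⨅ s ∈ {s : Finset ι | ∏ i ∈ s, MvPolynomial.X i ∈ I},
    Ideal.span ((fun i => (MvPolynomial.X i : MvPolynomial ι k)) '' (s : Set ι))

/-- In the graded free module `⨁_j P(-deg j)` over `P = k[z_i : i ∈ ι]`, graded by
`w i = degree of z_i`, the vector `v` is homogeneous of degree `a`. -/
def IsHomogeneousVector {k ι A : Type*} [Field k] [AddCommGroup A] (w : ι → A) {n : ℕ}
    (deg : Fin n → A) (a : A) (v : Fin n → MvPolynomial ι k) : Prop :=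
  ∀ j, MvPolynomial.IsWeightedHomogeneous w (v j) (a - deg j)

/-- A minimal graded free resolution `⋯ → F_1 → F_0 → I → 0` of an ideal `I` of the polynomial ring
`P = k[z_i : i ∈ ι]`, where `P` is graded by an abelian group `A` and `z_i` has degree `w i`.
The free module `F_i` has rank `rank i` and its standard basis vector `e_j` has degree `deg i j`. -/
structure MinimalGradedResolution {k ι A : Type*} [Field k] [AddCommGroup A] (w : ι → A)
    (I : Ideal (MvPolynomial ι k)) where
  rank : ℕ → ℕ
  deg : ∀ i, Fin (rank i) → A
  /-- the differential `F_{i+1} → F_i` -/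
  d : ∀ i, (Fin (rank (i + 1)) → MvPolynomial ι k) →ₗ[MvPolynomial ι k]
    (Fin (rank i) → MvPolynomial ι k)
  /-- the augmentation `F_0 → I` -/
  aug : (Fin (rank 0) → MvPolynomial ι k) →ₗ[MvPolynomial ι k] I
  d_graded : ∀ i a v, IsHomogeneousVector w (deg (i + 1)) a v →
    IsHomogeneousVector w (deg i) a (d i v)
  aug_graded : ∀ a v, IsHomogeneousVector w (deg 0) a v →
    MvPolynomial.IsWeightedHomogeneous w (aug v : MvPolynomial ι k) a
  aug_surjective : Function.Surjective aug
  exact_zero : Function.Exact (d 0) aug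
  exact_succ : ∀ i, Function.Exact (d (i + 1)) (d i)
  minimal : ∀ i, LinearMap.range (d i) ≤
    Ideal.span (Set.range (MvPolynomial.X : ι → MvPolynomial ι k)) •
      (⊤ : Submodule (MvPolynomial ι k) (Fin (rank i) → MvPolynomial ι k))

/-- The number of basis vectors of degree `a` in `F_i`. -/
noncomputable def MinimalGradedResolution.betti {k ι A : Type*} [Field k] [AddCommGroup A]
    {w : ι → A} {I : Ideal (MvPolynomial ι k)} (F : MinimalGradedResolution w I)
    (i : ℕ) (a : A) : ℕ :=
  Nat.card {j : Fin (F.rank i) // F.deg i j = a}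

/-- `β` is the table of graded Betti numbers `β_{i,a}(I)` for the grading by `w`: minimal graded
free resolutions of `I` exist, and each of them has the numbers `β i a`. -/
def IsBettiTable {k ι A : Type*} [Field k] [AddCommGroup A] (w : ι → A)
    (I : Ideal (MvPolynomial ι k)) (β : ℕ → A → ℕ) : Prop :=
  Nonempty (MinimalGradedResolution w I) ∧
    ∀ F : MinimalGradedResolution w I, ∀ i a, F.betti i a = β i a

/-- The standard `ℤ`-grading: every variable has degree `1`. -/
def standardDegree (ι : Type*) : ι → ℤ := fun _ => 1

/-- The fine multigrading by `ℤ^ι`: the variable `z_i` has degree `e_i`. -/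
def multiDegree (ι : Type*) [DecidableEq ι] : ι → (ι → ℤ) := fun i => Pi.single i 1

/-- The `ℤ^m`-grading of `k[x_1, …, x_m, y_1, …, y_m]` in which `x_i` and `y_i` both have
degree `e_i`. -/
def pairedDegree (m : ℕ) : Fin m ⊕ Fin m → (Fin m → ℤ) :=
  Sum.elim (multiDegree (Fin m)) (multiDegree (Fin m))

/-! The dual `𝒪^∨` is the intersection, over all points `v`, of the primes generated by the
variables of the covector of `v`. A squarefree monomial lies in it when its variables meet every
covector, that is, when they form a covering set.

The geometric input is convexity. If a covering set contains `x_i` and `y_i`, one of them can be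
dropped. Otherwise dropping `x_i` leaves some `v` with `h_i(v) > c_i` uncovered, dropping `y_i`
leaves some `u` with `h_i(u) < c_i` uncovered, and the point of the segment `uv` on `H_i` is covered
by nothing (`IsCovering.erase`). So every covering set contains one without pairs, on which
identifying `x_i` with `y_i` is injective. Hence substituting `y_i = x_i` for `i ∈ T` sends `𝒪^∨`
onto the intersection of the images of the primes (`map_rename_alexanderDual`). These images are
again monomial primes, and for `i ∉ T` none contains `x_i - y_i`, because no covector contains both
variables. This is regularity in any order.

The differences are also regular on `S`, so a free resolution of `𝒪^∨` stays exact modulo all of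
them (`exact_modulo_differenceIdeal`). The substitution preserves constant terms, hence minimality,
and the basis degrees do not change. A minimal resolution of `𝒪^∨` in the fine grading thus gives,
by coarsening and specialization, resolutions for all the tables. Existence and uniqueness of Betti
tables are proved by minimal covers and by comparison of resolutions. -/

/-! ### Graded free modules and graded maps -/

section GradedFree

open MvPolynomial

variable {k ι A : Type*} [Field k] [AddCommGroup A] {w : ι → A}

/-- The homogeneous component of degree `a` of a vector of a graded free module. -/
noncomputable def vectorComponent (w : ι → A) {n : ℕ} (deg : Fin n → A) (a : A) :
    (Fin n → MvPolynomial ι k) →ₗ[k] (Fin n → MvPolynomial ι k) :=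
  LinearMap.pi fun j => weightedHomogeneousComponent w (a - deg j) ∘ₗ LinearMap.proj j

theorem isHomogeneousVector_vectorComponent {n : ℕ} (deg : Fin n → A) (a : A)
    (v : Fin n → MvPolynomial ι k) :
    IsHomogeneousVector w deg a (vectorComponent w deg a v) :=
  fun _ => weightedHomogeneousComponent_isWeightedHomogeneous _ _

theorem IsHomogeneousVector.vectorComponent_eq [DecidableEq A] {n : ℕ} {deg : Fin n → A} {a : A}
    {v : Fin n → MvPolynomial ι k} (hv : IsHomogeneousVector w deg a v) (b : A) :
    vectorComponent w deg b v = if a = b then v else 0 := by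
  funext j
  have := weightedHomogeneousComponent_of_mem (m := b - deg j)
    ((mem_weightedHomogeneousSubmodule k w (a - deg j) (v j)).2 (hv j))
  change weightedHomogeneousComponent w (b - deg j) (v j) = _
  rw [this]
  by_cases h : a = b
  · simp [h]
  · have : b - deg j ≠ a - deg j := fun h' => h (sub_left_injective h').symm
    simp [h, this]

theorem exists_finset_eq_sum_vectorComponent {n : ℕ} (deg : Fin n → A)
    (v : Fin n → MvPolynomial ι k) :
    ∃ D : Finset A, v = ∑ a ∈ D, vectorComponent w deg a v := by
  classical
  refine ⟨Finset.univ.biUnion fun j => (v j).support.image fun s => Finsupp.weight w s + deg j, ?_⟩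
  funext j
  ext s
  rw [Finset.sum_apply, coeff_sum]
  simp only [vectorComponent, LinearMap.pi_apply, LinearMap.comp_apply, LinearMap.proj_apply,
    coeff_weightedHomogeneousComponent]
  simp_rw [eq_sub_iff_add_eq]
  rw [Finset.sum_ite_eq]
  split_ifs with h
  · rfl
  · by_contra hs
    exact h (Finset.mem_biUnion.2 ⟨j, Finset.mem_univ _,
      Finset.mem_image.2 ⟨s, mem_support_iff.2 hs, rfl⟩⟩)

theorem isHomogeneousVector_single {n : ℕ} (deg : Fin n → A) (j : Fin n) :
    IsHomogeneousVector w deg (deg j) (Pi.single j (1 : MvPolynomial ι k)) := by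
  intro i
  rcases eq_or_ne i j with rfl | h
  · simpa using isWeightedHomogeneous_one k w
  · simpa [Pi.single_eq_of_ne h] using isWeightedHomogeneous_zero k w _

/-- A linear map of graded free modules that sends each basis vector to a homogeneous vector of the
same degree. -/
def IsGradedMap (w : ι → A) {n m : ℕ} (deg : Fin n → A) (deg' : Fin m → A)
    (f : (Fin n → MvPolynomial ι k) →ₗ[MvPolynomial ι k] (Fin m → MvPolynomial ι k)) : Prop :=
  ∀ j, IsHomogeneousVector w deg' (deg j) (f (Pi.single j 1))

theorem linearMap_apply_eq_sum {R : Type*} [CommRing R] {M : Type*} [AddCommGroup M] [Module R M]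
    {n : ℕ} (f : (Fin n → R) →ₗ[R] M) (v : Fin n → R) :
    f v = ∑ j, v j • f (Pi.single j 1) := by
  conv_lhs => rw [pi_eq_sum_univ' v, map_sum]
  refine Finset.sum_congr rfl fun j _ => ?_
  rw [map_smul]

theorem linearMap_apply_apply_eq_sum {R : Type*} [CommRing R] {n m : ℕ}
    (f : (Fin n → R) →ₗ[R] (Fin m → R)) (v : Fin n → R) (i : Fin m) :
    f v i = ∑ j, v j * f (Pi.single j 1) i := by
  rw [linearMap_apply_eq_sum f v, Finset.sum_apply]
  rfl

namespace IsGradedMap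

variable {n m : ℕ} {deg : Fin n → A} {deg' : Fin m → A}
  {f : (Fin n → MvPolynomial ι k) →ₗ[MvPolynomial ι k] (Fin m → MvPolynomial ι k)}

theorem isHomogeneousVector (hf : IsGradedMap w deg deg' f) {a : A} {v : Fin n → MvPolynomial ι k}
    (hv : IsHomogeneousVector w deg a v) : IsHomogeneousVector w deg' a (f v) := by
  intro i
  rw [linearMap_apply_apply_eq_sum]
  refine IsWeightedHomogeneous.sum _ _ _ fun j _ => ?_
  have := (hv j).mul (hf j i)
  rwa [sub_add_sub_cancel] at this

theorem vectorComponent_apply (hf : IsGradedMap w deg deg' f) (b : A)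
    (v : Fin n → MvPolynomial ι k) :
    vectorComponent w deg' b (f v) = f (vectorComponent w deg b v) := by
  classical
  obtain ⟨D, hD⟩ := exists_finset_eq_sum_vectorComponent (w := w) deg v
  have h1 : vectorComponent w deg b v = ∑ a ∈ D, if a = b then vectorComponent w deg a v else 0 := by
    conv_lhs => rw [hD, map_sum]
    exact Finset.sum_congr rfl fun a _ =>
      (isHomogeneousVector_vectorComponent deg a v).vectorComponent_eq b
  rw [h1]
  conv_lhs => rw [hD, map_sum, map_sum]
  rw [map_sum]
  refine Finset.sum_congr rfl fun a _ => ?_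
  rw [(hf.isHomogeneousVector (isHomogeneousVector_vectorComponent deg a v)).vectorComponent_eq]
  split_ifs <;> simp

theorem comp {l : ℕ} {deg'' : Fin l → A}
    {g : (Fin m → MvPolynomial ι k) →ₗ[MvPolynomial ι k] (Fin l → MvPolynomial ι k)}
    (hg : IsGradedMap w deg' deg'' g) (hf : IsGradedMap w deg deg' f) :
    IsGradedMap w deg deg'' (g ∘ₗ f) :=
  fun j => hg.isHomogeneousVector (hf j)

/-- A graded map lifts to a graded map along a graded map with larger range. -/
theorem exists_lift {l : ℕ} {deg'' : Fin l → A}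
    {g : (Fin l → MvPolynomial ι k) →ₗ[MvPolynomial ι k] (Fin m → MvPolynomial ι k)}
    (hf : IsGradedMap w deg deg' f) (hg : IsGradedMap w deg'' deg' g)
    (h : ∀ v, f v ∈ LinearMap.range g) :
    ∃ e : (Fin n → MvPolynomial ι k) →ₗ[MvPolynomial ι k] (Fin l → MvPolynomial ι k),
      IsGradedMap w deg deg'' e ∧ ∀ v, g (e v) = f v := by
  classical
  have key : ∀ j, ∃ u, IsHomogeneousVector w deg'' (deg j) u ∧ g u = f (Pi.single j 1) := by
    intro j
    -- The preimage `u` need not be homogeneous, but `g` commutes with components, so its component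
    -- of degree `deg j` is a preimage too.
    obtain ⟨u, hu⟩ := h (Pi.single j 1)
    refine ⟨_, isHomogeneousVector_vectorComponent deg'' (deg j) u, ?_⟩
    rw [← hg.vectorComponent_apply, hu, (hf j).vectorComponent_eq, if_pos rfl]
  choose u hu hgu using key
  refine ⟨(Pi.basisFun _ _).constr (MvPolynomial ι k) u, fun j => ?_, fun v => ?_⟩
  · rw [← Pi.basisFun_apply (MvPolynomial ι k), Module.Basis.constr_basis]
    exact hu j
  · rw [linearMap_apply_eq_sum f v, linearMap_apply_eq_sum _ v, map_sum]
    refine Finset.sum_congr rfl fun j _ => ?_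
    rw [map_smul, ← hgu, ← Pi.basisFun_apply (MvPolynomial ι k), Module.Basis.constr_basis]

end IsGradedMap

/-- Used for the homotopies between resolutions, whose degrees play no role. -/
theorem exists_linearMap_lift {R M N : Type*} [CommRing R] [AddCommGroup M] [Module R M]
    [AddCommGroup N] [Module R N] {n : ℕ} (f : (Fin n → R) →ₗ[R] N) (g : M →ₗ[R] N)
    (h : ∀ v, f v ∈ LinearMap.range g) : ∃ e : (Fin n → R) →ₗ[R] M, ∀ v, g (e v) = f v := by
  choose u hu using h
  refine ⟨(Pi.basisFun _ _).constr R fun j => u (Pi.single j 1), fun v => ?_⟩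
  rw [linearMap_apply_eq_sum f v, linearMap_apply_eq_sum _ v, map_sum]
  refine Finset.sum_congr rfl fun j _ => ?_
  have hb := (Pi.basisFun R (Fin n)).constr_basis R (fun j => u (Pi.single j 1)) j
  rw [Pi.basisFun_apply] at hb
  rw [map_smul, hb, hu]

theorem mem_span_range_X_iff {p : MvPolynomial ι k} :
    p ∈ Ideal.span (Set.range (X : ι → MvPolynomial ι k)) ↔ constantCoeff p = 0 := by
  rw [← Set.image_univ, mem_ideal_span_X_image, constantCoeff_eq]
  constructor
  · intro h
    by_contra h0
    obtain ⟨i, -, hi⟩ := h 0 (mem_support_iff.2 h0)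
    exact hi rfl
  · intro h s hs
    by_contra! h'
    have : s = 0 := Finsupp.ext fun i => h' i (Set.mem_univ _)
    exact mem_support_iff.1 hs (this ▸ h)

theorem mem_smul_top_pi_iff {R : Type*} [CommRing R] {n : ℕ} (J : Ideal R) (v : Fin n → R) :
    v ∈ J • (⊤ : Submodule R (Fin n → R)) ↔ ∀ j, v j ∈ J := by
  constructor
  · intro h
    refine Submodule.smul_induction_on h (fun r hr x _ j => J.mul_mem_right _ hr)
      fun x y hx hy j => J.add_mem (hx j) (hy j)
  · intro h
    rw [pi_eq_sum_univ' v]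
    exact Submodule.sum_mem _ fun j _ => Submodule.smul_mem_smul (h j) trivial

/-- Turns minimality of a resolution into vanishing of constant terms, which can be checked
entrywise. -/
theorem mem_irrelevant_smul_top_iff {n : ℕ} (v : Fin n → MvPolynomial ι k) :
    v ∈ Ideal.span (Set.range (X : ι → MvPolynomial ι k)) •
      (⊤ : Submodule (MvPolynomial ι k) (Fin n → MvPolynomial ι k)) ↔
      ∀ j, constantCoeff (v j) = 0 := by
  rw [mem_smul_top_pi_iff]
  simp_rw [mem_span_range_X_iff]

theorem IsHomogeneousVector.constantCoeff_eq_zero {n : ℕ} {deg : Fin n → A} {a : A}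
    {v : Fin n → MvPolynomial ι k} (hv : IsHomogeneousVector w deg a v) {j : Fin n}
    (hj : deg j ≠ a) : constantCoeff (v j) = 0 := by
  rw [constantCoeff_eq]
  refine (hv j).coeff_eq_zero 0 ?_
  rw [map_zero]
  exact fun h => hj (sub_eq_zero.1 h.symm).symm

end GradedFree

/-! ### Existence of minimal graded free resolutions -/

section Existence

open MvPolynomial

variable {k ι A : Type*} [Field k] [AddCommGroup A] {w : ι → A}

/-- A graded submodule of a graded free module of finite rank. -/
structure GradedSubmodule (k : Type*) {ι A : Type*} [Field k] [AddCommGroup A] (w : ι → A) where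
  rank : ℕ
  deg : Fin rank → A
  carrier : Submodule (MvPolynomial ι k) (Fin rank → MvPolynomial ι k)
  component_mem : ∀ v ∈ carrier, ∀ a, vectorComponent w deg a v ∈ carrier

/-- Closure under components makes the homogeneous elements generate, and Noetherianity selects
finitely many of them. -/
theorem GradedSubmodule.exists_generators [Finite ι] (N : GradedSubmodule k w) :
    ∃ (n : ℕ) (deg : Fin n → A) (g : Fin n → (Fin N.rank → MvPolynomial ι k)),
      (∀ j, IsHomogeneousVector w N.deg (deg j) (g j)) ∧
      Submodule.span (MvPolynomial ι k) (Set.range g) = N.carrier := by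
  let H : Set (Fin N.rank → MvPolynomial ι k) :=
    {v | v ∈ N.carrier ∧ ∃ a, IsHomogeneousVector w N.deg a v}
  have hH : Submodule.span (MvPolynomial ι k) H = N.carrier := by
    refine le_antisymm (Submodule.span_le.2 fun v hv => hv.1) fun v hv => ?_
    obtain ⟨D, hD⟩ := exists_finset_eq_sum_vectorComponent (w := w) N.deg v
    rw [hD]
    exact Submodule.sum_mem _ fun a _ => Submodule.subset_span
      ⟨N.component_mem v hv a, a, isHomogeneousVector_vectorComponent _ _ _⟩
  obtain ⟨s, hsH, hs⟩ := (Submodule.fg_span_iff_fg_span_finset_subset H).1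
    (IsNoetherian.noetherian (R := MvPolynomial ι k) (M := Fin N.rank → MvPolynomial ι k) _)
  choose a ha using fun v : s => (hsH v.2).2
  refine ⟨s.card, fun j => a (s.equivFin.symm j), fun j => (s.equivFin.symm j).1,
    fun j => ha _, ?_⟩
  rw [← hH, hs]
  congr 1
  ext v
  constructor
  · rintro ⟨j, rfl⟩
    exact (s.equivFin.symm j).2
  · intro hv
    exact ⟨s.equivFin ⟨v, hv⟩, by simp⟩

theorem span_range_succAbove_eq {R M : Type*} [CommRing R] [AddCommGroup M] [Module R M] {n : ℕ}
    {g : Fin (n + 1) → M} {j : Fin (n + 1)} {v : Fin (n + 1) → R} (hv : ∑ i, v i • g i = 0)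
    (hj : IsUnit (v j)) :
    Submodule.span R (Set.range (g ∘ j.succAbove)) = Submodule.span R (Set.range g) := by
  refine le_antisymm (Submodule.span_mono (Set.range_comp_subset_range _ _)) ?_
  rw [Submodule.span_le]
  rintro _ ⟨i, rfl⟩
  have hmem : ∀ l, g (j.succAbove l) ∈ Submodule.span R (Set.range (g ∘ j.succAbove)) :=
    fun l => Submodule.subset_span ⟨l, rfl⟩
  rcases Fin.eq_self_or_eq_succAbove j i with rfl | ⟨l, rfl⟩
  · rw [Fin.sum_univ_succAbove _ i, add_eq_zero_iff_eq_neg] at hv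
    obtain ⟨u, hu⟩ := hj
    rw [SetLike.mem_coe, ← Submodule.smul_mem_iff_of_isUnit _ ⟨u, hu⟩, hv]
    exact Submodule.neg_mem _ (Submodule.sum_mem _ fun l _ => Submodule.smul_mem _ _ (hmem l))
  · exact hmem l

/-- A graded submodule is the image of a graded free module under a graded map whose kernel lies in
the multiple by the irrelevant ideal. -/
theorem GradedSubmodule.exists_minimal_cover [Finite ι]
    (hw : ∀ s : ι →₀ ℕ, Finsupp.weight w s = 0 → s = 0) (N : GradedSubmodule k w) :
    ∃ (n : ℕ) (deg : Fin n → A)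
      (f : (Fin n → MvPolynomial ι k) →ₗ[MvPolynomial ι k] (Fin N.rank → MvPolynomial ι k)),
      IsGradedMap w deg N.deg f ∧ LinearMap.range f = N.carrier ∧
      ∀ v, f v = 0 → ∀ j, constantCoeff (v j) = 0 := by
  classical
  -- Minimality comes from taking the least possible number of homogeneous generators.
  have hex := N.exists_generators
  obtain ⟨deg, g, hg, hspan⟩ := Nat.find_spec hex
  have hmin := fun n => Nat.find_min hex (m := n)
  generalize Nat.find hex = n at *
  have hf : ∀ v, (Pi.basisFun (MvPolynomial ι k) (Fin n)).constr (MvPolynomial ι k) g v =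
      ∑ j, v j • g j := fun v => by simp [Module.Basis.constr_apply_fintype]
  have hgr : IsGradedMap w deg N.deg
      ((Pi.basisFun (MvPolynomial ι k) (Fin n)).constr (MvPolynomial ι k) g) := by
    intro j
    rw [← Pi.basisFun_apply (MvPolynomial ι k), Module.Basis.constr_basis]
    exact hg j
  refine ⟨n, deg, _, hgr, by rw [Module.Basis.constr_range, hspan], fun v hv j => ?_⟩
  by_contra hj
  obtain ⟨n, rfl⟩ : ∃ n', n = n' + 1 := Nat.exists_eq_succ_of_ne_zero (by
    rintro rfl
    exact j.elim0)
  refine hmin n (Nat.lt_succ_self n) ⟨deg ∘ j.succAbove, g ∘ j.succAbove, fun _ => hg _, ?_⟩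
  -- The component of degree `deg j` of the relation `v` is again a relation. By `hw` its `j`-th
  -- entry is the constant term of `v j`, a unit, so `g j` is redundant.
  have hv' := hgr.vectorComponent_apply (deg j) v
  rw [hv, map_zero, hf] at hv'
  rw [← hspan]
  refine span_range_succAbove_eq hv'.symm ?_
  have : vectorComponent w deg (deg j) v j = C (constantCoeff (v j)) := by
    change weightedHomogeneousComponent w (deg j - deg j) (v j) = _
    ext s
    rw [sub_self, coeff_weightedHomogeneousComponent, coeff_C, constantCoeff_eq]
    by_cases hs : s = 0
    · simp [hs]
    · rw [if_neg (fun h => hs (hw s h)), if_neg (Ne.symm hs)]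
  rw [this]
  exact (isUnit_iff_ne_zero.2 hj).map C

namespace GradedSubmodule

variable [Finite ι] (hw : ∀ s : ι →₀ ℕ, Finsupp.weight w s = 0 → s = 0) (N : GradedSubmodule k w)

/-- The rank of a minimal graded free cover. -/
noncomputable def coverRank : ℕ := (N.exists_minimal_cover hw).choose

/-- The degrees of the basis of a minimal graded free cover. -/
noncomputable def coverDeg : Fin (N.coverRank hw) → A :=
  (N.exists_minimal_cover hw).choose_spec.choose

/-- A minimal graded free cover. -/
noncomputable def cover : (Fin (N.coverRank hw) → MvPolynomial ι k) →ₗ[MvPolynomial ι k]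
    (Fin N.rank → MvPolynomial ι k) :=
  (N.exists_minimal_cover hw).choose_spec.choose_spec.choose

theorem isGradedMap_cover : IsGradedMap w (N.coverDeg hw) N.deg (N.cover hw) :=
  (N.exists_minimal_cover hw).choose_spec.choose_spec.choose_spec.1

theorem range_cover : LinearMap.range (N.cover hw) = N.carrier :=
  (N.exists_minimal_cover hw).choose_spec.choose_spec.choose_spec.2.1

theorem constantCoeff_eq_zero_of_cover_eq_zero {v} (hv : N.cover hw v = 0) (j) :
    constantCoeff (v j) = 0 :=
  (N.exists_minimal_cover hw).choose_spec.choose_spec.choose_spec.2.2 v hv j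

/-- The kernel of a minimal graded free cover. -/
noncomputable def syzygy : GradedSubmodule k w where
  rank := N.coverRank hw
  deg := N.coverDeg hw
  carrier := LinearMap.ker (N.cover hw)
  component_mem v hv a := by
    rw [LinearMap.mem_ker] at hv ⊢
    rw [← (N.isGradedMap_cover hw).vectorComponent_apply, hv, map_zero]

/-- The minimal graded free cover of the kernel of a minimal graded free cover. -/
noncomputable def syzygyCover :
    (Fin ((N.syzygy hw).coverRank hw) → MvPolynomial ι k) →ₗ[MvPolynomial ι k]
      (Fin (N.coverRank hw) → MvPolynomial ι k) :=
  (N.syzygy hw).cover hw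

theorem isGradedMap_syzygyCover :
    IsGradedMap w ((N.syzygy hw).coverDeg hw) (N.coverDeg hw) (N.syzygyCover hw) :=
  (N.syzygy hw).isGradedMap_cover hw

theorem exact_syzygyCover_cover : Function.Exact (N.syzygyCover hw) (N.cover hw) :=
  LinearMap.exact_iff.2 ((N.syzygy hw).range_cover hw).symm

theorem exact_syzygyCover :
    Function.Exact ((N.syzygy hw).syzygyCover hw) (N.syzygyCover hw) :=
  (N.syzygy hw).exact_syzygyCover_cover hw

theorem range_syzygyCover_le : LinearMap.range (N.syzygyCover hw) ≤
    Ideal.span (Set.range (X : ι → MvPolynomial ι k)) •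
      (⊤ : Submodule (MvPolynomial ι k) (Fin (N.coverRank hw) → MvPolynomial ι k)) := by
  intro v hv
  exact (mem_irrelevant_smul_top_iff v).2
    (N.constantCoeff_eq_zero_of_cover_eq_zero hw ((N.exact_syzygyCover_cover hw v).2 hv))

/-- The iterated syzygies. -/
noncomputable abbrev iteratedSyzygy (i : ℕ) : GradedSubmodule k w :=
  Nat.rec N (fun _ M => M.syzygy hw) i

end GradedSubmodule

/-- An ideal generated by homogeneous elements as a graded submodule of the free module of rank
one. -/
noncomputable def gradedSubmoduleOfIdeal (w : ι → A) (I : Ideal (MvPolynomial ι k))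
    (hI : ∀ p ∈ I, ∀ a, weightedHomogeneousComponent w a p ∈ I) : GradedSubmodule k w where
  rank := 1
  deg := fun _ => 0
  carrier := Submodule.comap (LinearMap.proj 0) I
  component_mem _ hv _ := hI _ hv _

/-- Minimal graded free resolutions of homogeneous ideals exist if only constants have degree
zero. -/
theorem nonempty_minimalGradedResolution [Finite ι]
    (hw : ∀ s : ι →₀ ℕ, Finsupp.weight w s = 0 → s = 0) (I : Ideal (MvPolynomial ι k))
    (hI : ∀ p ∈ I, ∀ a, weightedHomogeneousComponent w a p ∈ I) :
    Nonempty (MinimalGradedResolution w I) := by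
  let N := gradedSubmoduleOfIdeal w I hI
  let z : Fin N.rank := (0 : Fin 1)
  have hz : ∀ j : Fin N.rank, j = z := fun j => Subsingleton.elim (α := Fin 1) j z
  have hmem : ∀ v, (N.cover hw v) z ∈ I := fun v => by
    have : N.cover hw v ∈ N.carrier := N.range_cover hw ▸ ⟨v, rfl⟩
    exact this
  let α : (Fin (N.coverRank hw) → MvPolynomial ι k) →ₗ[MvPolynomial ι k] I :=
    LinearMap.codRestrict I (LinearMap.proj z ∘ₗ N.cover hw) hmem
  have haug : ∀ v, N.cover hw v = 0 ↔ α v = 0 := fun v => by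
    rw [Subtype.ext_iff]
    exact ⟨fun h => congrFun h z, fun h => funext fun j => by rw [hz j]; exact h⟩
  exact ⟨{
    rank := fun i => (N.iteratedSyzygy hw i).coverRank hw
    deg := fun i => (N.iteratedSyzygy hw i).coverDeg hw
    d := fun i => (N.iteratedSyzygy hw i).syzygyCover hw
    aug := α
    d_graded := fun i a v hv =>
      ((N.iteratedSyzygy hw i).isGradedMap_syzygyCover hw).isHomogeneousVector hv
    aug_graded := fun a v hv => by
      have := (N.isGradedMap_cover hw).isHomogeneousVector hv z
      rwa [show N.deg z = 0 from rfl, sub_zero] at this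
    aug_surjective := by
      rintro ⟨p, hp⟩
      have : (fun _ => p) ∈ LinearMap.range (N.cover hw) := by
        rw [N.range_cover hw]
        exact hp
      obtain ⟨v, hv⟩ := this
      exact ⟨v, Subtype.ext (congrFun hv z)⟩
    exact_zero := fun v => (haug v).symm.trans (N.exact_syzygyCover_cover hw v)
    exact_succ := fun i => (N.iteratedSyzygy hw i).exact_syzygyCover hw
    minimal := fun i => (N.iteratedSyzygy hw i).range_syzygyCover_le hw }⟩

end Existence

/-! ### Independence of Betti numbers from the resolution -/

section Uniqueness

open MvPolynomial

variable {k ι A : Type*} [Field k] [AddCommGroup A] {w : ι → A} {I : Ideal (MvPolynomial ι k)}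

namespace MinimalGradedResolution

theorem isGradedMap_d (F : MinimalGradedResolution w I) (i : ℕ) :
    IsGradedMap w (F.deg (i + 1)) (F.deg i) (F.d i) :=
  fun j => F.d_graded i _ _ (isHomogeneousVector_single _ j)

/-- The augmentation as a map to the free module of rank one. -/
noncomputable def augVector (F : MinimalGradedResolution w I) :
    (Fin (F.rank 0) → MvPolynomial ι k) →ₗ[MvPolynomial ι k] (Fin 1 → MvPolynomial ι k) :=
  LinearMap.pi fun _ => (Submodule.subtype I) ∘ₗ F.aug

theorem isGradedMap_augVector (F : MinimalGradedResolution w I) :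
    IsGradedMap w (F.deg 0) (fun _ => 0) F.augVector := by
  intro j i
  rw [sub_zero]
  exact F.aug_graded _ _ (isHomogeneousVector_single _ j)

theorem augVector_eq_iff (F G : MinimalGradedResolution w I) {v u} :
    F.augVector v = G.augVector u ↔ F.aug v = G.aug u :=
  ⟨fun h => Subtype.ext (congrFun h 0), fun h => funext fun _ => congrArg Subtype.val h⟩

theorem d_d (F : MinimalGradedResolution w I) (i : ℕ) (v) : F.d i (F.d (i + 1) v) = 0 :=
  (F.exact_succ i _).2 ⟨v, rfl⟩

theorem constantCoeff_d (F : MinimalGradedResolution w I) (i : ℕ) (v) (j) :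
    constantCoeff (F.d i v j) = 0 :=
  (mem_irrelevant_smul_top_iff _).1 (F.minimal i ⟨v, rfl⟩) j

theorem exists_graded_lift (F G : MinimalGradedResolution w I) (i : ℕ)
    {f : (Fin (F.rank i) → MvPolynomial ι k) →ₗ[MvPolynomial ι k]
      (Fin (G.rank i) → MvPolynomial ι k)}
    (hf : IsGradedMap w (F.deg i) (G.deg i) f)
    (hfz : ∀ v, f (F.d i v) ∈ LinearMap.range (G.d i)) :
    ∃ f' : (Fin (F.rank (i + 1)) → MvPolynomial ι k) →ₗ[MvPolynomial ι k]
        (Fin (G.rank (i + 1)) → MvPolynomial ι k),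
      IsGradedMap w (F.deg (i + 1)) (G.deg (i + 1)) f' ∧
      (∀ v, G.d i (f' v) = f (F.d i v)) ∧
      ∀ v, f' (F.d (i + 1) v) ∈ LinearMap.range (G.d (i + 1)) := by
  obtain ⟨f', hf', h⟩ := (hf.comp (F.isGradedMap_d i)).exists_lift (G.isGradedMap_d i) hfz
  refine ⟨f', hf', h, fun v => (G.exact_succ i _).1 ?_⟩
  rw [h, LinearMap.comp_apply, F.d_d, map_zero]

/-- Comparison of two minimal resolutions: the composite of two lifts of the identity is the
identity modulo the irrelevant ideal. -/
theorem exists_comparison (F G : MinimalGradedResolution w I) (i : ℕ) :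
    ∃ (f : (Fin (F.rank i) → MvPolynomial ι k) →ₗ[MvPolynomial ι k]
        (Fin (G.rank i) → MvPolynomial ι k))
      (g : (Fin (G.rank i) → MvPolynomial ι k) →ₗ[MvPolynomial ι k]
        (Fin (F.rank i) → MvPolynomial ι k))
      (h : (Fin (F.rank i) → MvPolynomial ι k) →ₗ[MvPolynomial ι k]
        (Fin (F.rank (i + 1)) → MvPolynomial ι k))
      (t : (Fin (F.rank i) → MvPolynomial ι k) →ₗ[MvPolynomial ι k]
        (Fin (F.rank i) → MvPolynomial ι k)),
      IsGradedMap w (F.deg i) (G.deg i) f ∧ IsGradedMap w (G.deg i) (F.deg i) g ∧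
      (∀ v, f (F.d i v) ∈ LinearMap.range (G.d i)) ∧
      (∀ v, g (G.d i v) ∈ LinearMap.range (F.d i)) ∧
      (∀ v, g (f v) = v + F.d i (h v) + t v) ∧
      (∀ v, t (F.d i v) = 0) ∧ ∀ v j, constantCoeff (t v j) = 0 := by
  induction i with
  | zero =>
    have lift : ∀ F G : MinimalGradedResolution w I,
        ∃ f : (Fin (F.rank 0) → MvPolynomial ι k) →ₗ[MvPolynomial ι k]
          (Fin (G.rank 0) → MvPolynomial ι k),
        IsGradedMap w (F.deg 0) (G.deg 0) f ∧ (∀ v, G.aug (f v) = F.aug v) ∧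
        ∀ v, f (F.d 0 v) ∈ LinearMap.range (G.d 0) := by
      intro F G
      obtain ⟨f, hf, h⟩ := F.isGradedMap_augVector.exists_lift G.isGradedMap_augVector
        (fun v => (G.aug_surjective (F.aug v)).imp fun u hu => (augVector_eq_iff G F).2 hu)
      have h' : ∀ v, G.aug (f v) = F.aug v := fun v => (augVector_eq_iff G F).1 (h v)
      refine ⟨f, hf, h', fun v => (G.exact_zero _).1 ?_⟩
      rw [h']
      exact (F.exact_zero _).2 ⟨v, rfl⟩
    obtain ⟨f, hf, hfa, hfz⟩ := lift F G
    obtain ⟨g, hg, hga, hgz⟩ := lift G F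
    obtain ⟨h, hh⟩ := exists_linearMap_lift (g ∘ₗ f - LinearMap.id) (F.d 0) (fun v => by
      refine (F.exact_zero _).1 ?_
      simp [hfa, hga])
    refine ⟨f, g, h, 0, hf, hg, hfz, hgz, fun v => ?_, fun v => rfl, fun v j => by simp⟩
    rw [hh]
    simp
  | succ i ih =>
    obtain ⟨f, g, h, t, hf, hg, hfz, hgz, hgf, htz, htc⟩ := ih
    obtain ⟨f', hf', hff', hfz'⟩ := exists_graded_lift F G i hf hfz
    obtain ⟨g', hg', hgg', hgz'⟩ := exists_graded_lift G F i hg hgz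
    -- On applying `F.d i`, the terms cancel down to `t (F.d i v) = 0`, so the difference lifts
    -- through `F.d (i + 1)`.
    obtain ⟨h', hh'⟩ := exists_linearMap_lift (g' ∘ₗ f' - LinearMap.id - h ∘ₗ F.d i) (F.d (i + 1))
      (fun v => by
        refine (F.exact_succ i _).1 ?_
        simp only [LinearMap.sub_apply, LinearMap.comp_apply, LinearMap.id_apply, map_sub]
        rw [hgg', hff', hgf, htz]
        abel)
    -- The new error term is the old homotopy after the differential. It kills boundaries since `d d
    -- = 0`, and its constant terms vanish by minimality.
    refine ⟨f', g', h', h ∘ₗ F.d i, hf', hg', hfz', hgz', fun v => ?_, fun v => ?_, fun v j => ?_⟩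
    · rw [hh']
      simp only [LinearMap.sub_apply, LinearMap.comp_apply, LinearMap.id_apply]
      abel
    · rw [LinearMap.comp_apply, F.d_d, map_zero]
    · rw [LinearMap.comp_apply, linearMap_apply_apply_eq_sum, map_sum]
      refine Finset.sum_eq_zero fun l _ => ?_
      rw [map_mul, F.constantCoeff_d, zero_mul]

theorem betti_le (F G : MinimalGradedResolution w I) (i : ℕ) (a : A) :
    F.betti i a ≤ G.betti i a := by
  classical
  obtain ⟨f, g, h, t, hf, hg, -, -, hgf, -, htc⟩ := exists_comparison F G i
  -- The blocks of constant terms of `f` and `g` in degree `a`. Since `g ∘ f` is the identity on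
  -- constant terms, `N * M = 1` and ranks compare.
  let M : Matrix {j // G.deg i j = a} {j // F.deg i j = a} k :=
    fun l j => constantCoeff (f (Pi.single j.1 1) l.1)
  let N : Matrix {j // F.deg i j = a} {j // G.deg i j = a} k :=
    fun l j => constantCoeff (g (Pi.single j.1 1) l.1)
  have hNM : N * M = 1 := by
    ext l j
    have h1 := congrArg constantCoeff (congrFun (hgf (Pi.single j.1 1)) l.1)
    rw [linearMap_apply_apply_eq_sum, map_sum] at h1
    simp only [Pi.add_apply, map_add, htc, F.constantCoeff_d, add_zero, map_mul] at h1
    rw [Matrix.mul_apply]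
    have h2 : (1 : Matrix {j // F.deg i j = a} {j // F.deg i j = a} k) l j =
        constantCoeff ((Pi.single j.1 1 : Fin (F.rank i) → MvPolynomial ι k) l.1) := by
      simp only [Matrix.one_apply, Pi.single_apply, Subtype.ext_iff]
      split_ifs <;> simp
    -- Basis vectors of other degrees drop out, since a homogeneous entry of nonzero degree has no
    -- constant term.
    rw [h2, ← h1, ← Finset.sum_filter_of_ne (p := fun j => G.deg i j = a),
      Finset.sum_subtype (p := fun j => G.deg i j = a) _ (by simp)]
    · exact Finset.sum_congr rfl fun x _ => mul_comm _ _
    · intro x _ hx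
      by_contra hxa
      exact hx (by rw [(hf j.1).constantCoeff_eq_zero (j.2.symm ▸ hxa), zero_mul])
  have hinj : Function.Injective M.mulVecLin := by
    refine Function.LeftInverse.injective (g := N.mulVecLin) fun v => ?_
    simp [Matrix.mulVec_mulVec, hNM]
  have := card_le_of_injective k M.mulVecLin hinj
  rwa [← Nat.card_eq_fintype_card, ← Nat.card_eq_fintype_card] at this

theorem betti_eq (F G : MinimalGradedResolution w I) (i : ℕ) (a : A) :
    F.betti i a = G.betti i a :=
  le_antisymm (betti_le F G i a) (betti_le G F i a)

theorem isBettiTable (F : MinimalGradedResolution w I) : IsBettiTable w I F.betti :=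
  ⟨⟨F⟩, fun G i a => betti_eq G F i a⟩

end MinimalGradedResolution

end Uniqueness

/-! ### Squarefree monomial ideals and monomial primes -/

section SquarefreeMonomials

open MvPolynomial

variable {k ι κ : Type*} [Field k]

theorem prod_X_eq_monomial (s : Finset ι) :
    ∏ i ∈ s, (X i : MvPolynomial ι k) = monomial (∑ i ∈ s, Finsupp.single i 1) 1 :=
  (monomial_sum_one s _).symm

theorem sum_single_one_apply [DecidableEq ι] (s : Finset ι) (j : ι) :
    (∑ i ∈ s, Finsupp.single i 1 : ι →₀ ℕ) j = if j ∈ s then 1 else 0 := by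
  simp [Finsupp.finsetSum_apply, Finsupp.single_apply]

theorem prod_X_mem_span_range_iff {V : Type*} (C : V → Finset ι) (s : Finset ι) :
    ∏ i ∈ s, X i ∈ Ideal.span (Set.range fun v => ∏ i ∈ C v, (X i : MvPolynomial ι k)) ↔
      ∃ v, C v ⊆ s := by
  classical
  have : (Set.range fun v => ∏ i ∈ C v, (X i : MvPolynomial ι k)) =
      (fun e => monomial e (1 : k)) '' Set.range fun v => ∑ i ∈ C v, Finsupp.single i 1 := by
    rw [← Set.range_comp]
    exact congrArg Set.range (funext fun v => prod_X_eq_monomial _)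
  rw [this, mem_ideal_span_monomial_image, prod_X_eq_monomial]
  simp only [support_monomial, one_ne_zero, if_false, Finset.mem_singleton, forall_eq,
    Set.exists_range_iff]
  refine exists_congr fun v => ⟨fun h i hi => ?_, fun h i => ?_⟩
  · by_contra his
    have := h i
    rw [sum_single_one_apply, sum_single_one_apply, if_pos hi, if_neg his] at this
    omega
  · rw [sum_single_one_apply, sum_single_one_apply]
    split_ifs with h1 h2
    exacts [le_rfl, absurd (h h1) h2, zero_le_one, le_rfl]

/-- The Alexander dual of a squarefree monomial ideal is the intersection of the monomial primes of
its generators. -/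
theorem alexanderDual_span_range {V : Type*} (C : V → Finset ι) :
    alexanderDual (Ideal.span (Set.range fun v => ∏ i ∈ C v, (X i : MvPolynomial ι k))) =
      ⨅ v, Ideal.span ((fun i => (X i : MvPolynomial ι k)) '' (C v : Set ι)) := by
  refine le_antisymm (le_iInf fun v => ?_) (le_iInf₂ fun s hs => ?_)
  · exact iInf₂_le (C v) ((prod_X_mem_span_range_iff C (C v)).2 ⟨v, subset_rfl⟩)
  obtain ⟨v, hv⟩ := (prod_X_mem_span_range_iff C s).1 hs
  exact (iInf_le _ v).trans (Ideal.span_mono (Set.image_mono (Finset.coe_subset.2 hv)))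

/-- The ideal is the kernel of the substitution `e` that sets the variables in `s` to zero, and the
target is a domain. -/
theorem isPrime_span_X_image (s : Set ι) :
    (Ideal.span ((fun i => (X i : MvPolynomial ι k)) '' s)).IsPrime := by
  classical
  let e : MvPolynomial ι k →ₐ[k] MvPolynomial ι k := aeval fun i => if i ∈ s then 0 else X i
  have hsub : ∀ p, p - e p ∈ Ideal.span ((fun i => (X i : MvPolynomial ι k)) '' s) := by
    intro p
    induction p using MvPolynomial.induction_on with
    | C a => simp [e, algebraMap_eq]
    | add p q hp hq =>
      rw [map_add, add_sub_add_comm]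
      exact Ideal.add_mem _ hp hq
    | mul_X p i hp =>
      have : p * X i - e (p * X i) = (p - e p) * X i + e p * (X i - e (X i)) := by
        rw [map_mul]
        ring
      rw [this]
      refine Ideal.add_mem _ (Ideal.mul_mem_right _ _ hp) (Ideal.mul_mem_left _ _ ?_)
      by_cases hi : i ∈ s
      · simpa [e, hi] using Ideal.subset_span (Set.mem_image_of_mem (fun i => (X i : MvPolynomial ι k)) hi)
      · simp [e, hi]
  have hker : Ideal.span ((fun i => (X i : MvPolynomial ι k)) '' s) = RingHom.ker e := by
    refine le_antisymm (Ideal.span_le.2 ?_) fun p hp => ?_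
    · rintro _ ⟨i, hi, rfl⟩
      rw [SetLike.mem_coe, RingHom.mem_ker]
      simp [e, hi]
    · have := hsub p
      rwa [(RingHom.mem_ker).1 hp, sub_zero] at this
  rw [hker]
  exact RingHom.ker_isPrime e

theorem map_rename_span_X_image (ρ : ι → κ) (s : Set ι) :
    (Ideal.span ((fun i => (X i : MvPolynomial ι k)) '' s)).map (rename ρ) =
      Ideal.span ((fun i => (X i : MvPolynomial κ k)) '' (ρ '' s)) := by
  rw [Ideal.map_span, Set.image_image, Set.image_image]
  simp

end SquarefreeMonomials

/-! ### Covering sets and identification of variables -/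

namespace OrientedArrangement

open MvPolynomial

variable {d m : ℕ} (𝒜 : OrientedArrangement d m) (k : Type*) [Field k]

/-- The variables that divide the monomial of a point. -/
noncomputable def covector (v : Fin d → ℝ) : Finset (Fin m ⊕ Fin m) :=
  (Finset.univ.filter fun i => 𝒜.c i < 𝒜.h i v).disjSum
    (Finset.univ.filter fun i => 𝒜.h i v < 𝒜.c i)

variable {𝒜} in
theorem inl_mem_covector {v : Fin d → ℝ} {i : Fin m} :
    Sum.inl i ∈ 𝒜.covector v ↔ 𝒜.c i < 𝒜.h i v := by
  simp [covector]

variable {𝒜} in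
theorem inr_mem_covector {v : Fin d → ℝ} {i : Fin m} :
    Sum.inr i ∈ 𝒜.covector v ↔ 𝒜.h i v < 𝒜.c i := by
  simp [covector]

theorem alexanderDual_orientedMatroidIdeal :
    alexanderDual (𝒜.orientedMatroidIdeal k) =
      ⨅ v, Ideal.span ((fun z => (X z : MvPolynomial (Fin m ⊕ Fin m) k)) ''
        (𝒜.covector v : Set (Fin m ⊕ Fin m))) := by
  rw [← alexanderDual_span_range, orientedMatroidIdeal]
  congr 3
  funext v
  rw [covector, Finset.prod_disjSum, pointMonomial]

/-- Writing the primes through signed covectors matches the form in `map_rename_alexanderDual`. -/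
theorem alexanderDual_matroidIdeal :
    alexanderDual (𝒜.matroidIdeal k) =
      ⨅ v, Ideal.span ((fun i => (X i : MvPolynomial (Fin m) k)) ''
        (Sum.elim id id '' (𝒜.covector v : Set (Fin m ⊕ Fin m)))) := by
  have := alexanderDual_span_range (k := k)
    fun v => Finset.univ.filter fun i => 𝒜.h i v ≠ 𝒜.c i
  refine Eq.trans this (iInf_congr fun v => ?_)
  congr 2
  ext i
  simp only [Finset.coe_filter, Finset.mem_univ, true_and, Set.mem_ofPred_eq, Set.mem_image,
    Finset.mem_coe, Sum.exists, inl_mem_covector, inr_mem_covector, Sum.elim_inl, Sum.elim_inr,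
    id_eq, exists_eq_right]
  rw [ne_iff_lt_or_gt, or_comm]

/-- A set of variables that meets the covector of each point. -/
def IsCovering (B : Finset (Fin m ⊕ Fin m)) : Prop :=
  ∀ v, ∃ z ∈ 𝒜.covector v, z ∈ B

/-- Between an uncovered point on the positive side of `H_i` and one on the negative side there
would be an uncovered point on `H_i`. -/
theorem IsCovering.erase {B : Finset (Fin m ⊕ Fin m)} (hB : 𝒜.IsCovering B) (i : Fin m) :
    𝒜.IsCovering (B.erase (Sum.inl i)) ∨ 𝒜.IsCovering (B.erase (Sum.inr i)) := by
  by_contra! h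
  obtain ⟨hl, hr⟩ := h
  simp only [IsCovering, not_forall, not_exists, not_and, Finset.mem_erase] at hl hr
  obtain ⟨v, hv⟩ := hl
  obtain ⟨u, hu⟩ := hr
  have hvi : 𝒜.c i < 𝒜.h i v := by
    obtain ⟨z, hz, hzB⟩ := hB v
    have : z = Sum.inl i := by
      by_contra hne
      exact hv z hz hne hzB
    rwa [this, inl_mem_covector] at hz
  have hui : 𝒜.h i u < 𝒜.c i := by
    obtain ⟨z, hz, hzB⟩ := hB u
    have : z = Sum.inr i := by
      by_contra hne
      exact hu z hz hne hzB
    rwa [this, inr_mem_covector] at hz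
  set a := 𝒜.h i v - 𝒜.c i with ha
  set b := 𝒜.c i - 𝒜.h i u with hb
  have ha0 : 0 < a := sub_pos.2 hvi
  have hb0 : 0 < b := sub_pos.2 hui
  have hab : 0 < a + b := add_pos ha0 hb0
  -- The weights `b` and `a` are chosen so that the convex combination of `v` and `u` lies on `H_i`.
  have hx : ∀ j, (a + b) * (𝒜.h j ((a + b)⁻¹ • (b • v + a • u)) - 𝒜.c j) =
      b * (𝒜.h j v - 𝒜.c j) + a * (𝒜.h j u - 𝒜.c j) := by
    intro j
    simp only [map_smul, map_add, smul_eq_mul]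
    field_simp
    ring
  obtain ⟨z, hz, hzB⟩ := hB ((a + b)⁻¹ • (b • v + a • u))
  have hxi := hx i
  rw [← ha, show 𝒜.h i u - 𝒜.c i = -b by rw [hb]; ring,
    show b * a + a * -b = 0 by ring] at hxi
  have hxi' := sub_eq_zero.1 ((mul_eq_zero.1 hxi).resolve_left hab.ne')
  -- The variable covering this point has index `j ≠ i`. Since `v` and `u` are uncovered after the
  -- erasures, both lie weakly on the other side of `H_j`, and so does the combination.
  rcases z with j | j
  · rw [inl_mem_covector] at hz
    have hji : j ≠ i := by
      rintro rfl
      exact hz.ne' hxi'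
    have h1 : 𝒜.h j v ≤ 𝒜.c j := not_lt.1 fun h =>
      hv _ (inl_mem_covector.2 h) (by simpa using hji) hzB
    have h2 : 𝒜.h j u ≤ 𝒜.c j := not_lt.1 fun h =>
      hu _ (inl_mem_covector.2 h) (by simp) hzB
    have h3 := mul_pos hab (sub_pos.2 hz)
    rw [hx] at h3
    have h4 := mul_nonpos_of_nonneg_of_nonpos hb0.le (sub_nonpos.2 h1)
    have h5 := mul_nonpos_of_nonneg_of_nonpos ha0.le (sub_nonpos.2 h2)
    linarith
  · rw [inr_mem_covector] at hz
    have hji : j ≠ i := by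
      rintro rfl
      exact hz.ne hxi'
    have h1 : 𝒜.c j ≤ 𝒜.h j v := not_lt.1 fun h =>
      hv _ (inr_mem_covector.2 h) (by simp) hzB
    have h2 : 𝒜.c j ≤ 𝒜.h j u := not_lt.1 fun h =>
      hu _ (inr_mem_covector.2 h) (by simpa using hji) hzB
    have h3 := mul_neg_of_pos_of_neg hab (sub_neg.2 hz)
    rw [hx] at h3
    have h4 := mul_nonneg hb0.le (sub_nonneg.2 h1)
    have h5 := mul_nonneg ha0.le (sub_nonneg.2 h2)
    linarith

/-- Pairs are removed one variable at a time by `IsCovering.erase`. In terms of ideals, `𝒪^∨` has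
generators divisible by no `x_i y_i`. -/
theorem IsCovering.exists_subset (B : Finset (Fin m ⊕ Fin m)) (hB : 𝒜.IsCovering B) :
    ∃ B' ⊆ B, 𝒜.IsCovering B' ∧ ∀ i, ¬(Sum.inl i ∈ B' ∧ Sum.inr i ∈ B') := by
  induction B using Finset.strongInduction with
  | H B ih =>
    by_cases h : ∀ i, ¬(Sum.inl i ∈ B ∧ Sum.inr i ∈ B)
    · exact ⟨B, subset_rfl, hB, h⟩
    · push Not at h
      obtain ⟨i, hl, hr⟩ := h
      rcases hB.erase 𝒜 i with h' | h'
      · obtain ⟨B', hsub, hB'⟩ := ih _ (Finset.erase_ssubset hl) h'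
        exact ⟨B', hsub.trans (Finset.erase_subset _ _), hB'⟩
      · obtain ⟨B', hsub, hB'⟩ := ih _ (Finset.erase_ssubset hr) h'
        exact ⟨B', hsub.trans (Finset.erase_subset _ _), hB'⟩

theorem prod_X_mem_alexanderDual {B : Finset (Fin m ⊕ Fin m)} (hB : 𝒜.IsCovering B) :
    ∏ z ∈ B, X z ∈ alexanderDual (𝒜.orientedMatroidIdeal k) := by
  rw [alexanderDual_orientedMatroidIdeal, Ideal.mem_iInf]
  intro v
  obtain ⟨z, hz, hzB⟩ := hB v
  exact Ideal.mem_of_dvd _ (Finset.dvd_prod_of_mem _ hzB) (Ideal.subset_span (Set.mem_image_of_mem _ hz))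

/-- Identifying some of the variables `x_i` with the corresponding `y_i` commutes with intersecting
the monomial primes. -/
theorem map_rename_alexanderDual {κ : Type*} {ρ : Fin m ⊕ Fin m → κ}
    (hρ : ∀ z z', ρ z = ρ z' → z = z' ∨ z = z'.swap) :
    (alexanderDual (𝒜.orientedMatroidIdeal k)).map (rename ρ) =
      ⨅ v, Ideal.span ((fun z => (X z : MvPolynomial κ k)) ''
        (ρ '' (𝒜.covector v : Set (Fin m ⊕ Fin m)))) := by
  classical
  refine le_antisymm (le_iInf fun v => ?_) fun p hp => ?_
  · rw [← map_rename_span_X_image]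
    refine Ideal.map_mono ?_
    rw [alexanderDual_orientedMatroidIdeal]
    exact iInf_le _ v
  · rw [p.as_sum]
    refine Ideal.sum_mem _ fun s hs => ?_
    -- A monomial of `p` is pulled back to all variables whose image divides it. This set may
    -- contain pairs, so it is shrunk to a set `B` on which `ρ` is injective. The image of the
    -- product over `B` is then squarefree and divides the monomial.
    have hcov : 𝒜.IsCovering (Finset.univ.filter fun z => s (ρ z) ≠ 0) := by
      intro v
      have := (Ideal.mem_iInf.1 hp) v
      rw [mem_ideal_span_X_image] at this
      obtain ⟨_, ⟨z, hz, rfl⟩, hzs⟩ := this s hs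
      exact ⟨z, hz, by simpa using hzs⟩
    obtain ⟨B, hBs, hB, hpair⟩ := hcov.exists_subset 𝒜
    have hinj : Set.InjOn ρ B := by
      intro z hz z' hz' h
      refine (hρ z z' h).resolve_right ?_
      rintro rfl
      rcases z' with i | i
      · exact hpair i ⟨hz', hz⟩
      · exact hpair i ⟨hz, hz'⟩
    have hmem := Ideal.mem_map_of_mem (rename ρ) (𝒜.prod_X_mem_alexanderDual k hB)
    refine Ideal.mem_of_dvd _ ?_ hmem
    rw [map_prod]
    simp only [rename_X]
    rw [← Finset.prod_image (f := fun l => (X l : MvPolynomial κ k)) hinj, prod_X_eq_monomial,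
      monomial_dvd_monomial]
    refine ⟨Or.inr fun l => ?_, one_dvd _⟩
    rw [sum_single_one_apply]
    split_ifs with hl
    · obtain ⟨z, hz, rfl⟩ := Finset.mem_image.1 hl
      have := (Finset.mem_filter.1 (hBs hz)).2
      omega
    · exact Nat.zero_le _

theorem map_rename_alexanderDual_eq_alexanderDual_matroidIdeal :
    (alexanderDual (𝒜.orientedMatroidIdeal k)).map (rename (Sum.elim id id)) =
      alexanderDual (𝒜.matroidIdeal k) := by
  rw [alexanderDual_matroidIdeal, map_rename_alexanderDual]
  rintro (i | i) (j | j) h <;> simp_all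

end OrientedArrangement

/-! ### Regularity of the differences `x_i - y_i` -/

namespace OrientedArrangement

open MvPolynomial

variable {d m : ℕ} (𝒜 : OrientedArrangement d m) (k : Type*) [Field k]

/-- The element `x_i - y_i`. -/
noncomputable def variableDifference (i : Fin m) : MvPolynomial (Fin m ⊕ Fin m) k :=
  X (Sum.inl i) - X (Sum.inr i)

/-- The ideal generated by `x_i - y_i` for `i ∈ T`. -/
noncomputable def differenceIdeal (T : Set (Fin m)) : Ideal (MvPolynomial (Fin m ⊕ Fin m) k) :=
  Ideal.span (variableDifference k '' T)

open Classical in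
/-- The map on variables that replaces `y_i` by `x_i` for `i ∈ T`. -/
noncomputable def collapse (T : Set (Fin m)) : Fin m ⊕ Fin m → Fin m ⊕ Fin m :=
  Sum.elim Sum.inl fun i => if i ∈ T then Sum.inl i else Sum.inr i

theorem index_collapse (T : Set (Fin m)) (z : Fin m ⊕ Fin m) :
    Sum.elim id id (collapse T z) = (Sum.elim id id z : Fin m) := by
  rcases z with i | i
  · rfl
  · simp only [collapse, Sum.elim_inr]
    split_ifs <;> rfl

theorem eq_or_eq_swap_of_index_eq {z z' : Fin m ⊕ Fin m}
    (h : (Sum.elim id id z : Fin m) = Sum.elim id id z') : z = z' ∨ z = z'.swap := by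
  rcases z with i | i <;> rcases z' with j | j <;> simp_all

theorem collapse_eq_collapse {T : Set (Fin m)} (z z' : Fin m ⊕ Fin m)
    (h : collapse T z = collapse T z') : z = z' ∨ z = z'.swap := by
  refine eq_or_eq_swap_of_index_eq ?_
  rw [← index_collapse T, h, index_collapse]

theorem sub_rename_collapse_mem (T : Set (Fin m)) (p : MvPolynomial (Fin m ⊕ Fin m) k) :
    p - rename (collapse T) p ∈ differenceIdeal k T := by
  induction p using MvPolynomial.induction_on with
  | C a => simp
  | add p q hp hq =>
    rw [map_add, add_sub_add_comm]
    exact Ideal.add_mem _ hp hq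
  | mul_X p z hp =>
    have : p * X z - rename (collapse T) (p * X z) =
        (p - rename (collapse T) p) * X z +
          rename (collapse T) p * (X z - rename (collapse T) (X z)) := by
      rw [map_mul]
      ring
    rw [this]
    refine Ideal.add_mem _ (Ideal.mul_mem_right _ _ hp) (Ideal.mul_mem_left _ _ ?_)
    rw [rename_X]
    rcases z with i | i
    · simp [collapse]
    · by_cases hi : i ∈ T
      · have := Ideal.subset_span (Set.mem_image_of_mem (variableDifference k) hi)
        rw [← neg_mem_iff, differenceIdeal]
        simpa [collapse, hi, variableDifference] using this
      · simp [collapse, hi]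

theorem mem_differenceIdeal_iff (T : Set (Fin m)) (p : MvPolynomial (Fin m ⊕ Fin m) k) :
    p ∈ differenceIdeal k T ↔ rename (collapse T) p = 0 := by
  constructor
  · intro hp
    have : differenceIdeal k T ≤ RingHom.ker (rename (R := k) (collapse T)) := by
      rw [differenceIdeal, Ideal.span_le]
      rintro _ ⟨i, hi, rfl⟩
      rw [SetLike.mem_coe, RingHom.mem_ker]
      simp [variableDifference, collapse, hi]
    exact this hp
  · intro hp
    simpa [hp] using sub_rename_collapse_mem k T p

theorem rename_collapse_variableDifference {T : Set (Fin m)} {i : Fin m} (hi : i ∉ T) :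
    rename (collapse T) (variableDifference k i) = X (Sum.inl i) - X (Sum.inr i) := by
  simp [variableDifference, collapse, hi]

/-- Regularity on `S` itself: the difference ideal is the kernel of a map to a domain in which `x_i
- y_i` stays nonzero. -/
theorem mem_differenceIdeal_of_mul_mem {T : Set (Fin m)} {i : Fin m} (hi : i ∉ T)
    {p : MvPolynomial (Fin m ⊕ Fin m) k}
    (hp : variableDifference k i * p ∈ differenceIdeal k T) : p ∈ differenceIdeal k T := by
  rw [mem_differenceIdeal_iff, map_mul, rename_collapse_variableDifference k hi] at hp
  rw [mem_differenceIdeal_iff]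
  refine (mul_eq_zero.1 hp).resolve_left fun h => ?_
  exact Sum.inl_ne_inr (X_injective (R := k) (sub_eq_zero.1 h))

/-- Reduces regularity to monomial primes: the collapse changes a polynomial only by an element of
the difference ideal, its kernel, and the image of `𝒪^∨` generates an intersection of such primes.
-/
theorem mem_alexanderDual_sup_differenceIdeal_iff (T : Set (Fin m))
    (p : MvPolynomial (Fin m ⊕ Fin m) k) :
    p ∈ alexanderDual (𝒜.orientedMatroidIdeal k) ⊔ differenceIdeal k T ↔
      ∀ v, rename (collapse T) p ∈
        Ideal.span ((fun z => (X z : MvPolynomial (Fin m ⊕ Fin m) k)) ''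
          (collapse T '' (𝒜.covector v : Set (Fin m ⊕ Fin m)))) := by
  rw [← Ideal.mem_iInf, ← 𝒜.map_rename_alexanderDual k collapse_eq_collapse]
  constructor
  · intro hp
    obtain ⟨q, hq, r, hr, rfl⟩ := Submodule.mem_sup.1 hp
    rw [map_add, (mem_differenceIdeal_iff k T r).1 hr, add_zero]
    exact Ideal.mem_map_of_mem _ hq
  · intro hp
    have hle : (alexanderDual (𝒜.orientedMatroidIdeal k)).map (rename (collapse T)) ≤
        alexanderDual (𝒜.orientedMatroidIdeal k) ⊔ differenceIdeal k T := by
      rw [Ideal.map_le_iff_le_comap]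
      intro q hq
      rw [Ideal.mem_comap, ← sub_sub_cancel q (rename (collapse T) q)]
      exact Ideal.sub_mem _ (Ideal.mem_sup_left hq)
        (Ideal.mem_sup_right (sub_rename_collapse_mem k T q))
    rw [← sub_add_cancel p (rename (collapse T) p)]
    exact Ideal.add_mem _ (Ideal.mem_sup_right (sub_rename_collapse_mem k T p)) (hle hp)

theorem mem_alexanderDual_sup_of_mul_mem {T : Set (Fin m)} {i : Fin m} (hi : i ∉ T)
    {p : MvPolynomial (Fin m ⊕ Fin m) k}
    (hp : variableDifference k i * p ∈
      alexanderDual (𝒜.orientedMatroidIdeal k) ⊔ differenceIdeal k T) :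
    p ∈ alexanderDual (𝒜.orientedMatroidIdeal k) ⊔ differenceIdeal k T := by
  classical
  rw [mem_alexanderDual_sup_differenceIdeal_iff] at hp ⊢
  intro v
  have h := hp v
  rw [map_mul, rename_collapse_variableDifference k hi] at h
  -- If the prime contained `x_i - y_i`, it would contain both variables. As `i ∉ T`, both would lie
  -- in the covector of `v`, which is impossible.
  refine ((isPrime_span_X_image _).mem_or_mem h).resolve_left fun h' => ?_
  rw [mem_ideal_span_X_image] at h'
  have hmem : ∀ z : Fin m ⊕ Fin m,
      coeff (Finsupp.single z 1) (X (Sum.inl i) - X (Sum.inr i) :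
        MvPolynomial (Fin m ⊕ Fin m) k) ≠ 0 →
      z ∈ collapse T '' (𝒜.covector v : Set (Fin m ⊕ Fin m)) := by
    intro z hz
    obtain ⟨z', hz', hne⟩ := h' _ (mem_support_iff.2 hz)
    have : z = z' := by
      by_contra hzz
      exact hne (Finsupp.single_eq_of_ne (Ne.symm hzz))
    rwa [this]
  obtain ⟨z, hz, hzl⟩ := hmem (Sum.inl i) (by simp [coeff_X, Finsupp.single_left_inj])
  obtain ⟨z', hz', hzr⟩ := hmem (Sum.inr i) (by simp [coeff_X, Finsupp.single_left_inj])
  have h1 : z = Sum.inl i := by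
    rcases z with j | j <;> simp only [collapse, Sum.elim_inl, Sum.elim_inr] at hzl
    · exact hzl
    · split_ifs at hzl with hj
      exact absurd (Sum.inl_injective hzl ▸ hj) hi
  have h2 : z' = Sum.inr i := by
    rcases z' with j | j <;> simp only [collapse, Sum.elim_inl, Sum.elim_inr] at hzr
    · exact absurd hzr Sum.inl_ne_inr
    · split_ifs at hzr with hj
      exact hzr
  rw [h1, Finset.mem_coe, inl_mem_covector] at hz
  rw [h2, Finset.mem_coe, inr_mem_covector] at hz'
  exact lt_asymm hz hz'

theorem one_notMem_alexanderDual_sup_differenceIdeal (T : Set (Fin m)) :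
    (1 : MvPolynomial (Fin m ⊕ Fin m) k) ∉
      alexanderDual (𝒜.orientedMatroidIdeal k) ⊔ differenceIdeal k T := by
  rw [mem_alexanderDual_sup_differenceIdeal_iff]
  intro h
  -- Any point would do, since each gives a proper ideal.
  have := h 0
  rw [map_one] at this
  exact (isPrime_span_X_image _).ne_top ((Ideal.eq_top_iff_one _).2 this)

theorem mk_mem_smul_top_iff {R : Type*} [CommRing R] (I J : Ideal R) (p : R) :
    (Ideal.Quotient.mk I p) ∈ J • (⊤ : Submodule R (R ⧸ I)) ↔ p ∈ I ⊔ J := by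
  have : J • (⊤ : Submodule R (R ⧸ I)) = Submodule.map I.mkQ J := by
    rw [← Submodule.range_mkQ I, LinearMap.range_eq_map, ← Submodule.map_smul'']
    simp
  rw [this, sup_comm]
  exact ⟨fun ⟨q, hq, h⟩ => by
      rw [← sub_sub_cancel q p]
      exact Ideal.sub_mem _ (Ideal.mem_sup_left hq) (Ideal.mem_sup_right (Ideal.Quotient.eq.1 h)),
    fun h => by
      obtain ⟨q, hq, r, hr, rfl⟩ := Submodule.mem_sup.1 h
      refine ⟨q, hq, ?_⟩
      exact Ideal.Quotient.eq.2 (by simpa using hr)⟩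

theorem isRegular_variableDifference (σ : Equiv.Perm (Fin m)) :
    RingTheory.Sequence.IsRegular
      (MvPolynomial (Fin m ⊕ Fin m) k ⧸ alexanderDual (𝒜.orientedMatroidIdeal k))
      (List.ofFn fun i : Fin m => variableDifference k (σ i)) := by
  -- Initial segments of the sequence generate difference ideals, so regularity for arbitrary `T`
  -- handles every order.
  have htake : ∀ r, Ideal.ofList ((List.ofFn fun i : Fin m => variableDifference k (σ i)).take r) =
      differenceIdeal k (σ '' {i | i.1 < r}) := by
    intro r
    rw [Ideal.ofList, differenceIdeal]
    congr 1
    ext p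
    simp only [List.mem_take_iff_getElem, List.length_ofFn, List.getElem_ofFn]
    constructor
    · rintro ⟨j, hj, rfl⟩
      exact ⟨_, ⟨⟨j, (lt_min_iff.1 hj).2⟩, (lt_min_iff.1 hj).1, rfl⟩, rfl⟩
    · rintro ⟨_, ⟨j, hj, rfl⟩, rfl⟩
      exact ⟨j, lt_min hj j.2, rfl⟩
  constructor
  · constructor
    intro i hi
    rw [isSMulRegular_quotient_iff_mem_of_smul_mem, htake]
    rintro x hx
    obtain ⟨p, rfl⟩ := Ideal.Quotient.mk_surjective x
    rw [mk_mem_smul_top_iff]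
    rw [List.getElem_ofFn] at hx
    have hx' := (mk_mem_smul_top_iff _ _ (variableDifference k (σ ⟨i, by simpa using hi⟩) * p)).1 hx
    refine 𝒜.mem_alexanderDual_sup_of_mul_mem k ?_ hx'
    rintro ⟨j, hj, h⟩
    have := σ.injective h
    subst this
    exact lt_irrefl i hj
  · intro h
    have h1 : Ideal.Quotient.mk (alexanderDual (𝒜.orientedMatroidIdeal k)) 1 ∈
        (⊤ : Submodule (MvPolynomial (Fin m ⊕ Fin m) k) _) := trivial
    rw [h, ← List.take_length (l := List.ofFn _), htake, mk_mem_smul_top_iff] at h1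
    exact 𝒜.one_notMem_alexanderDual_sup_differenceIdeal k _ h1

end OrientedArrangement

/-! ### Exactness modulo a regular element -/

section ExactnessModuloIdeal

/-- A diagram chase. If `b v = θ u + q`, then `θ • a u` vanishes modulo `Q`, hence so does `a u`,
and `u` is `b u'` modulo `Q`. Now `v - θ u'` is a cycle modulo `Q`, so exactness at `M₂` applies. -/
theorem exists_sub_mem_sup_smul_top {S M₀ M₁ M₂ M₃ : Type*} [CommRing S] [AddCommGroup M₀]
    [AddCommGroup M₁] [AddCommGroup M₂] [AddCommGroup M₃] [Module S M₀] [Module S M₁]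
    [Module S M₂] [Module S M₃] {a : M₁ →ₗ[S] M₀} {b : M₂ →ₗ[S] M₁} {c : M₃ →ₗ[S] M₂}
    (hab : ∀ v, a (b v) = 0) {Q : Ideal S} {θ : S}
    (hθ : ∀ x : M₀, θ • x ∈ Q • (⊤ : Submodule S M₀) → x ∈ Q • (⊤ : Submodule S M₀))
    (h₁ : ∀ u, a u ∈ Q • (⊤ : Submodule S M₀) → ∃ u', u - b u' ∈ Q • (⊤ : Submodule S M₁))
    (h₂ : ∀ v, b v ∈ Q • (⊤ : Submodule S M₁) → ∃ u', v - c u' ∈ Q • (⊤ : Submodule S M₂))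
    (v : M₂) (hv : b v ∈ (Ideal.span {θ} ⊔ Q) • (⊤ : Submodule S M₁)) :
    ∃ u', v - c u' ∈ (Ideal.span {θ} ⊔ Q) • (⊤ : Submodule S M₂) := by
  rw [Submodule.sup_smul, Submodule.mem_sup] at hv
  obtain ⟨x, hx, q, hq, hxq⟩ := hv
  rw [Submodule.ideal_span_singleton_smul] at hx
  obtain ⟨u, -, rfl⟩ := (Submodule.mem_smul_pointwise_iff_exists _ _ _).1 hx
  have h0 := hab v
  rw [← hxq, map_add, map_smul, add_eq_zero_iff_eq_neg] at h0
  obtain ⟨u', hu'⟩ := h₁ u (hθ _ (h0 ▸ neg_mem (Submodule.smul_top_le_comap_smul_top Q a hq)))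
  have h3 : b (v - θ • u') ∈ Q • (⊤ : Submodule S M₁) := by
    have : b (v - θ • u') = θ • (u - b u') + q := by
      rw [map_sub, map_smul, ← hxq, smul_sub]
      abel
    rw [this]
    exact add_mem (Submodule.smul_mem _ _ hu') hq
  obtain ⟨u'', hu''⟩ := h₂ _ h3
  refine ⟨u'', ?_⟩
  have : v - c u'' = θ • u' + (v - θ • u' - c u'') := by abel
  rw [this, Submodule.sup_smul]
  refine Submodule.add_mem_sup ?_ hu''
  exact Submodule.smul_mem_smul (Ideal.mem_span_singleton_self θ) trivial

end ExactnessModuloIdeal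

/-! ### Coarsening of gradings -/

section Coarsening

open MvPolynomial

variable {k ι A B : Type*} [Field k] [AddCommGroup A] [AddCommGroup B] {w : ι → A} {w' : ι → B}
  {I : Ideal (MvPolynomial ι k)}

theorem MvPolynomial.IsWeightedHomogeneous.coarsen (φ : A →+ B) (hφ : ∀ i, w' i = φ (w i))
    {p : MvPolynomial ι k} {a : A} (hp : IsWeightedHomogeneous w p a) :
    IsWeightedHomogeneous w' p (φ a) := by
  intro s hs
  rw [← hp hs]
  simp [Finsupp.weight_apply, Finsupp.sum, hφ]

/-- Testing basis vectors only is what makes this immediate: a coarser grading can have more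
homogeneous vectors. -/
theorem IsGradedMap.coarsen (φ : A →+ B) (hφ : ∀ i, w' i = φ (w i)) {n m : ℕ} {deg : Fin n → A}
    {deg' : Fin m → A}
    {f : (Fin n → MvPolynomial ι k) →ₗ[MvPolynomial ι k] (Fin m → MvPolynomial ι k)}
    (hf : IsGradedMap w deg deg' f) : IsGradedMap w' (φ ∘ deg) (φ ∘ deg') f := by
  intro j i
  have := (hf j i).coarsen φ hφ
  rwa [map_sub] at this

/-- A minimal graded free resolution for a coarser grading. -/
noncomputable def MinimalGradedResolution.coarsen (F : MinimalGradedResolution w I) (φ : A →+ B)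
    (hφ : ∀ i, w' i = φ (w i)) : MinimalGradedResolution w' I where
  rank := F.rank
  deg i := φ ∘ F.deg i
  d := F.d
  aug := F.aug
  d_graded i _ _ hv := ((F.isGradedMap_d i).coarsen φ hφ).isHomogeneousVector hv
  aug_graded a v hv := by
    have := (F.isGradedMap_augVector.coarsen φ hφ).isHomogeneousVector hv 0
    rwa [Function.comp_apply, map_zero, sub_zero] at this
  aug_surjective := F.aug_surjective
  exact_zero := F.exact_zero
  exact_succ := F.exact_succ
  minimal := F.minimal

theorem MinimalGradedResolution.betti_coarsen (F : MinimalGradedResolution w I) (φ : A →+ B)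
    (hφ : ∀ i, w' i = φ (w i)) (i : ℕ) (a : B) :
    (F.coarsen φ hφ).betti i a = ∑ᶠ (b : A) (_ : φ b = a), F.betti i b := by
  classical
  have h1 : ∀ b, (∑ᶠ _ : φ b = a, F.betti i b) = if φ b = a then F.betti i b else 0 :=
    fun b => finsum_eq_if
  have hcard : ∀ b, F.betti i b = (Finset.univ.filter fun j => F.deg i j = b).card := fun b => by
    rw [betti, Nat.card_eq_fintype_card, Fintype.card_subtype]
  -- Only finitely many degrees occur, so the `finsum` is a genuine finite sum.
  have h2 : (Function.support fun b => ∑ᶠ _ : φ b = a, F.betti i b) ⊆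
      ((Finset.univ.image (F.deg i)).filter fun b => φ b = a : Finset A) := by
    intro b hb
    rw [Function.mem_support, h1] at hb
    have hb1 : φ b = a := by
      by_contra h
      exact hb (if_neg h)
    rw [if_pos hb1, hcard] at hb
    obtain ⟨j, hj⟩ := Finset.card_ne_zero.1 hb
    rw [Finset.coe_filter]
    exact ⟨Finset.mem_image.2 ⟨j, Finset.mem_univ _, (Finset.mem_filter.1 hj).2⟩, hb1⟩
  have h3 : (F.coarsen φ hφ).betti i a =
      (Finset.univ.filter fun j => φ (F.deg i j) = a).card := by
    rw [← Fintype.card_subtype, ← Nat.card_eq_fintype_card]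
    rfl
  rw [finsum_eq_sum_of_support_subset _ h2, h3, Finset.card_eq_sum_card_fiberwise (f := F.deg i)
    (t := (Finset.univ.image (F.deg i)).filter fun b => φ b = a)]
  · refine Finset.sum_congr rfl fun b hb => ?_
    have hb' := (Finset.mem_filter.1 hb).2
    rw [h1, if_pos hb', hcard, Finset.filter_filter]
    congr 1
    refine Finset.filter_congr fun j _ => ⟨fun h => h.2, fun h => ⟨h ▸ hb', h⟩⟩
  · intro j hj
    have hj' := (Finset.mem_filter.1 hj).2
    exact Finset.mem_filter.2 ⟨Finset.mem_image_of_mem _ (Finset.mem_univ _), hj'⟩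

end Coarsening

/-! ### Base change of graded maps -/

section BaseChange

/-- The base change along a ring homomorphism of a map of free modules. -/
noncomputable def piBaseChange {S R : Type*} [CommRing S] [CommRing R] (π : S →+* R) {n m : ℕ}
    (f : (Fin n → S) →ₗ[S] (Fin m → S)) : (Fin n → R) →ₗ[R] (Fin m → R) :=
  (Pi.basisFun R (Fin n)).constr R fun j => π ∘ f (Pi.single j 1)

theorem piBaseChange_comp {S R : Type*} [CommRing S] [CommRing R] (π : S →+* R) {n m : ℕ}
    (f : (Fin n → S) →ₗ[S] (Fin m → S)) (v : Fin n → S) :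
    piBaseChange π f (π ∘ v) = π ∘ f v := by
  funext i
  rw [Function.comp_apply, linearMap_apply_apply_eq_sum f v, map_sum]
  simp [piBaseChange, Module.Basis.constr_apply_fintype]

theorem piBaseChange_single {S R : Type*} [CommRing S] [CommRing R] (π : S →+* R) {n m : ℕ}
    (f : (Fin n → S) →ₗ[S] (Fin m → S)) (j : Fin n) :
    piBaseChange π f (Pi.single j 1) = π ∘ f (Pi.single j 1) := by
  rw [← Pi.basisFun_apply R, piBaseChange, Module.Basis.constr_basis]

open MvPolynomial

theorem MvPolynomial.IsWeightedHomogeneous.rename {k ι κ A : Type*} [Field k] [AddCommGroup A]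
    {w : ι → A} {w' : κ → A} {ρ : ι → κ} (hw : ∀ z, w z = w' (ρ z)) {p : MvPolynomial ι k} {a : A}
    (hp : IsWeightedHomogeneous w p a) : IsWeightedHomogeneous w' (MvPolynomial.rename ρ p) a := by
  intro s hs
  obtain ⟨u, rfl, hu⟩ := coeff_rename_ne_zero ρ p s hs
  rw [← hp hu, Finsupp.weight_apply, Finsupp.weight_apply,
    Finsupp.sum_mapDomain_index (by simp) (by simp [add_smul])]
  simp [Finsupp.sum, hw]

theorem IsGradedMap.piBaseChange {k ι κ A : Type*} [Field k] [AddCommGroup A] {w : ι → A}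
    {w' : κ → A} {ρ : ι → κ} (hw : ∀ z, w z = w' (ρ z)) {n m : ℕ} {deg : Fin n → A}
    {deg' : Fin m → A}
    {f : (Fin n → MvPolynomial ι k) →ₗ[MvPolynomial ι k] (Fin m → MvPolynomial ι k)}
    (hf : IsGradedMap w deg deg' f) :
    IsGradedMap w' deg deg' (_root_.piBaseChange (MvPolynomial.rename ρ : _ →ₐ[k] _).toRingHom f) := by
  intro j i
  rw [piBaseChange_single]
  exact (hf j i).rename hw

end BaseChange

/-! ### Specialization of a resolution at `y_i = x_i` -/

namespace OrientedArrangement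

open MvPolynomial

variable {d m : ℕ} (𝒜 : OrientedArrangement d m) {k : Type*} [Field k]

theorem differenceIdeal_insert (T : Set (Fin m)) (i : Fin m) :
    differenceIdeal k (insert i T) = Ideal.span {variableDifference k i} ⊔ differenceIdeal k T := by
  rw [differenceIdeal, Set.image_insert_eq, Ideal.span_insert, differenceIdeal]

theorem mem_smul_top_of_smul_mem {T : Set (Fin m)} {i : Fin m} (hi : i ∉ T) {n : ℕ}
    (v : Fin n → MvPolynomial (Fin m ⊕ Fin m) k)
    (hv : variableDifference k i • v ∈ differenceIdeal k T •
      (⊤ : Submodule (MvPolynomial (Fin m ⊕ Fin m) k) (Fin n → MvPolynomial (Fin m ⊕ Fin m) k))) :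
    v ∈ differenceIdeal k T • (⊤ : Submodule (MvPolynomial (Fin m ⊕ Fin m) k) _) := by
  rw [mem_smul_top_pi_iff] at hv ⊢
  exact fun j => mem_differenceIdeal_of_mul_mem k hi (hv j)

variable {𝒜} {A : Type*} [AddCommGroup A] {w : Fin m ⊕ Fin m → A}
  (F : MinimalGradedResolution w (alexanderDual (𝒜.orientedMatroidIdeal k)))

/-- A resolution of `𝒪^∨` stays exact modulo the elements `x_i - y_i`. -/
theorem exact_modulo_differenceIdeal (T : Finset (Fin m)) :
    (∀ v, (F.aug v : MvPolynomial (Fin m ⊕ Fin m) k) ∈ differenceIdeal k (T : Set (Fin m)) →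
      ∃ u, v - F.d 0 u ∈ differenceIdeal k (T : Set (Fin m)) •
        (⊤ : Submodule (MvPolynomial (Fin m ⊕ Fin m) k) _)) ∧
    ∀ i v, F.d i v ∈ differenceIdeal k (T : Set (Fin m)) •
        (⊤ : Submodule (MvPolynomial (Fin m ⊕ Fin m) k) _) →
      ∃ u, v - F.d (i + 1) u ∈ differenceIdeal k (T : Set (Fin m)) •
        (⊤ : Submodule (MvPolynomial (Fin m ⊕ Fin m) k) _) := by
  classical
  let I := alexanderDual (𝒜.orientedMatroidIdeal k)
  let α : (Fin (F.rank 0) → MvPolynomial (Fin m ⊕ Fin m) k) →ₗ[MvPolynomial (Fin m ⊕ Fin m) k]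
    MvPolynomial (Fin m ⊕ Fin m) k := Submodule.subtype I ∘ₗ F.aug
  have hα : ∀ (J : Ideal (MvPolynomial (Fin m ⊕ Fin m) k)) v,
      (F.aug v : MvPolynomial (Fin m ⊕ Fin m) k) ∈ J ↔
        α v ∈ J • (⊤ : Submodule (MvPolynomial (Fin m ⊕ Fin m) k) (MvPolynomial (Fin m ⊕ Fin m) k)) := by
    intro J v
    rw [smul_eq_mul, Ideal.mul_top]
    rfl
  simp_rw [hα]
  have hα0 : ∀ v, α (F.d 0 v) = 0 := fun v =>
    congrArg Subtype.val ((F.exact_zero _).2 ⟨v, rfl⟩)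
  induction T using Finset.induction_on with
  | empty =>
    simp only [Finset.coe_empty, differenceIdeal, Set.image_empty, Ideal.span_empty,
      Submodule.bot_smul, Submodule.mem_bot]
    refine ⟨fun v hv => ?_, fun i v hv => ?_⟩
    · obtain ⟨u, hu⟩ := (F.exact_zero v).1 (Subtype.ext hv)
      exact ⟨u, by rw [hu, sub_self]⟩
    · obtain ⟨u, hu⟩ := (F.exact_succ i v).1 hv
      exact ⟨u, by rw [hu, sub_self]⟩
  | insert i T hi ih =>
    obtain ⟨ih₀, ih₁⟩ := ih
    have hi' : i ∉ (T : Set (Fin m)) := hi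
    rw [Finset.coe_insert, differenceIdeal_insert]
    refine ⟨fun v hv => ?_, fun j => ?_⟩
    -- The resolution is continued by `S → S/𝒪^∨`, so exactness at `F_0` uses regularity on `S/𝒪^∨`.
    -- The later spots need regularity only on `S` and on free modules.
    · refine exists_sub_mem_sup_smul_top (a := Submodule.mkQ I) (fun v => ?_) (fun x hx => ?_)
        (fun u hu => ?_) ih₀ v hv
      · exact (Submodule.Quotient.mk_eq_zero _).2 (F.aug v).2
      · obtain ⟨p, rfl⟩ := Ideal.Quotient.mk_surjective x
        exact (mk_mem_smul_top_iff _ _ _).2 (𝒜.mem_alexanderDual_sup_of_mul_mem k hi'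
          ((mk_mem_smul_top_iff _ _ (variableDifference k i * p)).1 hx))
      · obtain ⟨p, hp, q, hq, rfl⟩ := Submodule.mem_sup.1 ((mk_mem_smul_top_iff _ _ u).1 hu)
        obtain ⟨v', hv'⟩ := F.aug_surjective ⟨p, hp⟩
        refine ⟨v', ?_⟩
        rw [show α v' = p from congrArg Subtype.val hv', add_sub_cancel_left, smul_eq_mul,
          Ideal.mul_top]
        exact hq
    · cases j with
      | zero =>
        refine exists_sub_mem_sup_smul_top hα0 (fun x hx => ?_) ih₀ (ih₁ 0)
        rw [smul_eq_mul, Ideal.mul_top] at hx ⊢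
        exact mem_differenceIdeal_of_mul_mem k hi' hx
      | succ j =>
        exact exists_sub_mem_sup_smul_top (F.d_d j) (mem_smul_top_of_smul_mem hi') (ih₁ j)
          (ih₁ (j + 1))

/-- The substitution `y_i = x_i`. -/
noncomputable def specialization (m : ℕ) (k : Type*) [Field k] :
    MvPolynomial (Fin m ⊕ Fin m) k →ₐ[k] MvPolynomial (Fin m) k :=
  rename (Sum.elim id id)

theorem specialization_surjective : Function.Surjective (specialization m k) :=
  rename_surjective _ fun i => ⟨Sum.inl i, rfl⟩

/-- The substitution and the full collapse factor through each other, so their kernels agree. -/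
theorem specialization_eq_zero_iff (p : MvPolynomial (Fin m ⊕ Fin m) k) :
    specialization m k p = 0 ↔ p ∈ differenceIdeal k Set.univ := by
  have h1 : (Sum.elim id id : Fin m ⊕ Fin m → Fin m) ∘ collapse Set.univ = Sum.elim id id :=
    funext fun z => index_collapse _ z
  have h2 : Sum.inl ∘ (Sum.elim id id : Fin m ⊕ Fin m → Fin m) = collapse Set.univ := by
    funext z
    rcases z with i | i <;> simp [collapse]
  rw [mem_differenceIdeal_iff, specialization]
  constructor
  · intro h
    rw [← h2, ← rename_rename, h, map_zero]
  · intro h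
    rw [← h1, ← rename_rename, h, map_zero]

theorem specialization_comp_eq_zero_iff {n : ℕ} (v : Fin n → MvPolynomial (Fin m ⊕ Fin m) k) :
    specialization m k ∘ v = 0 ↔ v ∈ differenceIdeal k (Set.univ : Set (Fin m)) •
      (⊤ : Submodule (MvPolynomial (Fin m ⊕ Fin m) k) _) := by
  rw [mem_smul_top_pi_iff, funext_iff]
  exact forall_congr' fun j => specialization_eq_zero_iff (v j)

theorem constantCoeff_specialization (p : MvPolynomial (Fin m ⊕ Fin m) k) :
    constantCoeff (specialization m k p) = constantCoeff p :=
  constantCoeff_rename _ _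

theorem mem_alexanderDual_matroidIdeal_iff (p : MvPolynomial (Fin m) k) :
    p ∈ alexanderDual (𝒜.matroidIdeal k) ↔
      ∃ q ∈ alexanderDual (𝒜.orientedMatroidIdeal k), specialization m k q = p := by
  rw [← map_rename_alexanderDual_eq_alexanderDual_matroidIdeal]
  exact Ideal.mem_map_iff_of_surjective _ specialization_surjective

theorem specialization_comp_surjective (n : ℕ) : Function.Surjective
    fun v : Fin n → MvPolynomial (Fin m ⊕ Fin m) k => specialization m k ∘ v :=
  specialization_surjective.comp_left

theorem specialization_comp_sub {n : ℕ} {v u : Fin n → MvPolynomial (Fin m ⊕ Fin m) k}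
    (h : v - u ∈ differenceIdeal k (Set.univ : Set (Fin m)) •
      (⊤ : Submodule (MvPolynomial (Fin m ⊕ Fin m) k) _)) :
    specialization m k ∘ v = specialization m k ∘ u := by
  rw [← specialization_comp_eq_zero_iff] at h
  funext j
  have := congrFun h j
  rw [Function.comp_apply, Pi.sub_apply, map_sub] at this
  exact sub_eq_zero.1 this

/-- The base change of a map of free modules along the substitution `y_i = x_i`. -/
noncomputable def specializeMap {n l : ℕ}
    (f : (Fin n → MvPolynomial (Fin m ⊕ Fin m) k) →ₗ[MvPolynomial (Fin m ⊕ Fin m) k]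
      (Fin l → MvPolynomial (Fin m ⊕ Fin m) k)) :
    (Fin n → MvPolynomial (Fin m) k) →ₗ[MvPolynomial (Fin m) k] (Fin l → MvPolynomial (Fin m) k) :=
  piBaseChange (specialization m k).toRingHom f

theorem specializeMap_comp {n l : ℕ}
    (f : (Fin n → MvPolynomial (Fin m ⊕ Fin m) k) →ₗ[MvPolynomial (Fin m ⊕ Fin m) k]
      (Fin l → MvPolynomial (Fin m ⊕ Fin m) k)) (v) :
    specializeMap f (specialization m k ∘ v) = specialization m k ∘ f v :=
  piBaseChange_comp (specialization m k).toRingHom f v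

theorem specializeMap_augVector_mem (v) :
    specializeMap F.augVector v 0 ∈ alexanderDual (𝒜.matroidIdeal k) := by
  obtain ⟨v, rfl⟩ := specialization_comp_surjective _ v
  rw [mem_alexanderDual_matroidIdeal_iff]
  refine ⟨F.aug v, (F.aug v).2, ?_⟩
  exact (congrFun (specializeMap_comp F.augVector v) 0).symm

/-- The augmentation of the specialized resolution. -/
noncomputable def specializedAug : (Fin (F.rank 0) → MvPolynomial (Fin m) k)
    →ₗ[MvPolynomial (Fin m) k] alexanderDual (𝒜.matroidIdeal k) :=
  LinearMap.codRestrict (alexanderDual (𝒜.matroidIdeal k))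
    (LinearMap.proj 0 ∘ₗ specializeMap F.augVector) (specializeMap_augVector_mem F)

theorem coe_specializedAug_comp (v) :
    (specializedAug F (specialization m k ∘ v) : MvPolynomial (Fin m) k) =
      specialization m k (F.aug v) :=
  congrFun (specializeMap_comp F.augVector v) 0

/-- The minimal graded free resolution of the dual of the specialized ideal obtained from a
resolution of `𝒪^∨` by the substitution `y_i = x_i`. -/
noncomputable def specializedResolution {w' : Fin m → A} (hw : ∀ z, w z = w' (Sum.elim id id z)) :
    MinimalGradedResolution w' (alexanderDual (𝒜.matroidIdeal k)) where
  rank := F.rank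
  deg := F.deg
  d i := specializeMap (F.d i)
  aug := specializedAug F
  d_graded i _ _ hv := ((F.isGradedMap_d i).piBaseChange hw).isHomogeneousVector hv
  aug_graded a v hv := by
    have := (F.isGradedMap_augVector.piBaseChange hw).isHomogeneousVector hv 0
    rwa [sub_zero] at this
  aug_surjective := by
    rintro ⟨p, hp⟩
    obtain ⟨q, hq, rfl⟩ := (mem_alexanderDual_matroidIdeal_iff p).1 hp
    obtain ⟨v, hv⟩ := F.aug_surjective ⟨q, hq⟩
    refine ⟨specialization m k ∘ v, Subtype.ext ?_⟩
    rw [coe_specializedAug_comp, hv]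
  exact_zero v := by
    obtain ⟨v, rfl⟩ := specialization_comp_surjective _ v
    -- A specialized vector vanishes when it comes from the full difference ideal times the free
    -- module, so exactness modulo that ideal is exactness after substitution.
    have hE := (exact_modulo_differenceIdeal F Finset.univ).1
    rw [Finset.coe_univ] at hE
    constructor
    · intro h
      have h' := congrArg Subtype.val h
      rw [coe_specializedAug_comp] at h'
      obtain ⟨u, hu⟩ := hE v ((specialization_eq_zero_iff _).1 h')
      exact ⟨specialization m k ∘ u, by
        rw [specializeMap_comp]
        exact (specialization_comp_sub hu).symm⟩
    · rintro ⟨u, hu⟩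
      obtain ⟨u, rfl⟩ := specialization_comp_surjective _ u
      rw [← hu, specializeMap_comp]
      refine Subtype.ext ?_
      rw [coe_specializedAug_comp, (F.exact_zero _).2 ⟨u, rfl⟩]
      exact map_zero _
  exact_succ i v := by
    obtain ⟨v, rfl⟩ := specialization_comp_surjective _ v
    have hE := (exact_modulo_differenceIdeal F Finset.univ).2 i
    rw [Finset.coe_univ] at hE
    constructor
    · intro h
      rw [specializeMap_comp, specialization_comp_eq_zero_iff] at h
      obtain ⟨u, hu⟩ := hE v h
      exact ⟨specialization m k ∘ u, by
        rw [specializeMap_comp]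
        exact (specialization_comp_sub hu).symm⟩
    · rintro ⟨u, hu⟩
      obtain ⟨u, rfl⟩ := specialization_comp_surjective _ u
      rw [← hu, specializeMap_comp, specializeMap_comp, F.d_d]
      funext j
      exact map_zero _
  minimal i := by
    rintro _ ⟨v, rfl⟩
    obtain ⟨v, rfl⟩ := specialization_comp_surjective _ v
    rw [mem_irrelevant_smul_top_iff]
    intro j
    rw [specializeMap_comp, Function.comp_apply, constantCoeff_specialization, F.constantCoeff_d]

theorem weight_multiDegree_eq_zero {ι : Type*} [DecidableEq ι] [Finite ι] (s : ι →₀ ℕ)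
    (hs : Finsupp.weight (multiDegree ι) s = 0) : s = 0 := by
  ext j
  have := congrFun hs j
  simpa [Finsupp.weight_apply, Finsupp.sum, multiDegree, Finset.sum_apply, Pi.single_apply]
    using this

theorem weightedHomogeneousComponent_mem_alexanderDual {w : Fin m ⊕ Fin m → A}
    (p : MvPolynomial (Fin m ⊕ Fin m) k) (hp : p ∈ alexanderDual (𝒜.orientedMatroidIdeal k))
    (a : A) :
    weightedHomogeneousComponent w a p ∈ alexanderDual (𝒜.orientedMatroidIdeal k) := by
  classical
  rw [alexanderDual_orientedMatroidIdeal, Ideal.mem_iInf] at hp ⊢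
  intro v
  have := hp v
  rw [mem_ideal_span_X_image] at this ⊢
  intro s hs
  rw [support_weightedHomogeneousComponent] at hs
  exact this s (Finset.mem_filter.1 hs).1

/-- The homomorphism from the fine degrees to the degrees in which `x_l` and `y_l` both have
degree `e_l`. -/
def pairing (m : ℕ) : (Fin m ⊕ Fin m → ℤ) →+ (Fin m → ℤ) where
  toFun b l := b (Sum.inl l) + b (Sum.inr l)
  map_zero' := rfl
  map_add' _ _ := funext fun _ => add_add_add_comm _ _ _ _

theorem pairedDegree_eq (z : Fin m ⊕ Fin m) :
    pairedDegree m z = pairing m (multiDegree _ z) := by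
  funext l
  rcases z with i | i <;> simp [pairedDegree, pairing, multiDegree, Pi.single_apply]

/-- The homomorphism from multidegrees to total degrees. -/
def totalDegreeHom (m : ℕ) : (Fin m → ℤ) →+ ℤ where
  toFun b := ∑ l, b l
  map_zero' := Finset.sum_const_zero
  map_add' _ _ := Finset.sum_add_distrib

theorem totalDegreeHom_single (i : Fin m) : totalDegreeHom m (Pi.single i 1) = 1 := by
  simp [totalDegreeHom, Pi.single_apply]

end OrientedArrangement

theorem proposition4p3 {k : Type*} [Field k] {d m : ℕ} (𝒜 : OrientedArrangement d m) :
    -- the elements `x_i - y_i`, in any order, form a regular sequence on `S/𝒪^∨`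
    (∀ σ : Equiv.Perm (Fin m),
      RingTheory.Sequence.IsRegular
        (MvPolynomial (Fin m ⊕ Fin m) k ⧸ alexanderDual (𝒜.orientedMatroidIdeal k))
        (List.ofFn fun i : Fin m =>
          (MvPolynomial.X (Sum.inl (σ i)) - MvPolynomial.X (Sum.inr (σ i)) :
            MvPolynomial (Fin m ⊕ Fin m) k))) ∧
    -- the `ℤ`-graded Betti numbers coincide
    (∃ β : ℕ → ℤ → ℕ,
      IsBettiTable (standardDegree _) (alexanderDual (𝒜.orientedMatroidIdeal k)) β ∧
      IsBettiTable (standardDegree _) (alexanderDual (𝒜.matroidIdeal k)) β) ∧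
    -- the `ℤ^m`-graded Betti numbers coincide, where `x_i` and `y_i` have degree `e_i`
    (∃ β : ℕ → (Fin m → ℤ) → ℕ,
      IsBettiTable (pairedDegree m) (alexanderDual (𝒜.orientedMatroidIdeal k)) β ∧
      IsBettiTable (multiDegree _) (alexanderDual (𝒜.matroidIdeal k)) β) ∧
    -- the `ℤ^{2m}`-graded Betti numbers of `𝒪^∨` add up to those of the specialization
    (∃ β : ℕ → (Fin m ⊕ Fin m → ℤ) → ℕ,
      IsBettiTable (multiDegree _) (alexanderDual (𝒜.orientedMatroidIdeal k)) β ∧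
      IsBettiTable (multiDegree _) (alexanderDual (𝒜.matroidIdeal k))
        (fun i a => ∑ᶠ (b : Fin m ⊕ Fin m → ℤ)
          (_ : ∀ l, b (Sum.inl l) + b (Sum.inr l) = a l), β i b)) := by
  -- Existence is needed only in the fine grading of `S`. `P` and `G` have the same ranks and basis
  -- degrees, so their Betti tables agree by definition, also after passing to total degrees.
  obtain ⟨F⟩ := nonempty_minimalGradedResolution OrientedArrangement.weight_multiDegree_eq_zero
    (alexanderDual (𝒜.orientedMatroidIdeal k))
    (OrientedArrangement.weightedHomogeneousComponent_mem_alexanderDual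
      (w := multiDegree (Fin m ⊕ Fin m)))
  let P := F.coarsen (OrientedArrangement.pairing m) OrientedArrangement.pairedDegree_eq
  let G := OrientedArrangement.specializedResolution P (w' := multiDegree (Fin m))
    (by rintro (i | i) <;> rfl)
  have hsum : ∀ z, standardDegree (Fin m ⊕ Fin m) z =
      OrientedArrangement.totalDegreeHom m (pairedDegree m z) := by
    rintro (i | i) <;> exact (OrientedArrangement.totalDegreeHom_single i).symm
  refine ⟨𝒜.isRegular_variableDifference k,
    ⟨_, (P.coarsen (OrientedArrangement.totalDegreeHom m) hsum).isBettiTable,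
      (G.coarsen (OrientedArrangement.totalDegreeHom m) fun i =>
        (OrientedArrangement.totalDegreeHom_single i).symm).isBettiTable⟩,
    ⟨_, P.isBettiTable, G.isBettiTable⟩, _, F.isBettiTable, ?_⟩
  have hβ : G.betti = fun i a => ∑ᶠ (b : Fin m ⊕ Fin m → ℤ)
      (_ : ∀ l, b (Sum.inl l) + b (Sum.inr l) = a l), F.betti i b := by
    funext i a
    refine (F.betti_coarsen _ OrientedArrangement.pairedDegree_eq i a).trans ?_
    refine finsum_congr fun b => finsum_congr_Prop ?_ fun _ => rfl
    exact propext funext_iff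
  exact hβ ▸ G.isBettiTable
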